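/- **Setting.** Let $K\ge 1$, let $\Omega\subseteq[0,\infty)$ be a measurable set, let $\mathcal P^1(\Omega)$ be the set of probability measures on $\Omega$ with finite first moment, and let $\|\mathbb G-\mathbb S\|_{\rm W}$ denote the 1-Wasserstein distance. Let $\mathbb F_1,\dots,\mathbb F_K\in\mathcal P^1(\Omega)$ be 1-sub-Gaussian, i.e. $\mathbb E\,e^{\lambda (X-\mathbb E X)}\le e^{\lambda^2/2}$ for $X\sim\mathbb F_i$ and all $\lambda\in\mathbb R$. Let $\Delta^{K-1}$ be the probability simplex and $\Xi=\{\sum_i\alpha(i)\mathbb F_i:\alpha\in\Delta^{K-1}\}$. Let $h:[0,1]\to[0,1]$ be measurable with $h(0)=0$; for a distribution with CDF $Q$ let $$U_h(Q)=\int_{-\infty}^0\big(h(1-Q(x))-h(1)\big)\,dx+\int_0^\infty h(1-Q(x))\,dx ,\qquad V(\alpha)=U_h\Big(\sum_i\alpha(i)\mathbb F_i\Big).$$ Assume that $U_h\le B$ on $\Xi$ for a constant $B>0$, that $U_h$ is finite on $\mathcal P^1(\Omega)$, and that it is Hölder continuous with exponent $q\in(0,1]$ and constant $\mathcal L\ge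 0$: $|U_h(\mathbb G_1)-U_h(\mathbb G_2)|\le\mathcal L\,\|\mathbb G_1-\mathbb G_2\|_{\rm W}^q$ for all $\mathbb G_1\in\Xi$ and $\mathbb G_2\in\mathcal P^1(\Omega)$. Put $$W=\sup_{\alpha\ne\beta\in\Delta^{K-1}}\frac{1}{\|\alpha-\beta\|_1}\Big\|\sum_i\alpha(i)\mathbb F_i-\sum_j\beta(j)\mathbb F_j\Big\|_{\rm W}.$$ **Discretization.** Let $\varepsilon>0$ and $\rho\in(0,1)$. Let $\Delta^{K-1}_\varepsilon$ be the set of $a\in\Delta^{K-1}$ such that $a(i)\in\{\varepsilon(n+\tfrac12):n=0,1,2,\dots\}$ for $i<K$ and $a(K)\ge\varepsilon/2$ (the last coordinate takes up the remainder; if $1/\varepsilon-K/2$ is a nonnegative integer then $a(K)$ is such a midpoint too). Assume that it is nonempty. Let $\alpha^\star$ maximize $V$ over $\Delta^{K-1}$, let $a^\star$ maximize $V$ over $\Delta^{K-1}_\varepsilon$, and let $\Delta(\varepsilon)=V(\alpha^\star)-V(a^\star)$ and $\Delta_{\min}(\varepsilon)=\min\{V(a^\star)-V(a):a\in\Delta_\varepsilon^{K-1},\,a\ne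 a^\star\}$ (with $\min\emptyset=\infty$). Let $T_0(\varepsilon)$ be the smallest integer $t\ge1$ such that $$\frac{\sqrt{2e\log s}+32}{\sqrt{\rho s\varepsilon/4}}\le\frac1{16}\Big(\frac{\Delta_{\min}(\varepsilon)}{2K\mathcal L}\Big)^{1/q}\qquad\text{for all integers } s\ge t$$ ($T_0(\varepsilon)=\infty$ if there is none, e.g. if $\Delta_{\min}(\varepsilon)=0$), and let $T(\varepsilon)=\frac2\varepsilon(T_0(\varepsilon)-1)$. **Algorithms.** In each round $t=1,\dots,T$ an arm $A_t$ is chosen on the basis of the past (and possibly internal randomization) and a reward $X_t$ is observed, which given the past and $A_t$ has distribution $\mathbb F_{A_t}$. Let $\tau_t(i)$ be the number of selections of arm $i$ in the first $t$ rounds, $\mathbb F_{i,t}$ the empirical distribution of the rewards of arm $i$ in these rounds, $c_t(i)=16\,\frac{\sqrt{2e\log T}+32}{\sqrt{\tau_t(i)}}$ and $\mathcal C_t(i)=\{\eta\in\mathcal P^1(\Omega):\|\mathbb F_{i,t}-\eta\|_{\rm W}\le c_t(i)\}$. Both algorithms sample each arm $N=\lceil\rho T\varepsilon/4\rceil$ times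 in the first $KN$ rounds. For $KN\le t<T$ they choose $a_t\in\arg\max_{a\in\Delta_\varepsilon^{K-1}}{\rm UCB}_t(a)$, keeping $a_t=a_{t-1}$ whenever $t>KN$ and $a_{t-1}$ is still a maximizer (other ties are broken arbitrarily), and then select $A_{t+1}\in\arg\max_i\{t\,a_t(i)-\tau_t(i)\}$. The index is - RS-UCB-M: ${\rm UCB}_t(a)=\sup\{U_h(\sum_ia(i)\eta_i):\eta_i\in\mathcal C_t(i)\ \forall i\}$; - CE-UCB-M: ${\rm UCB}_t(a)=U_h(\sum_ia(i)\mathbb F_{i,t})+\mathcal L\sum_i\big(a(i)\,c_t(i)\big)^q$. **Theorem 3.** For every integer $T>\max\{e^K,T(\varepsilon)\}$, under RS-UCB-M as well as under CE-UCB-M, $$V(\alpha^\star)-\mathbb E\Big[V\Big(\tfrac1T\tau_T\Big)\Big]\;\le\;\big[B+\mathcal L(W^q+1)\big]\left[\frac{64}{\sqrt{\varepsilon\rho T}}\Big(\sqrt{2e\log T}+32\Big)\right]^q+\Delta(\varepsilon).$$ -/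

import Mathlib

open MeasureTheory ProbabilityTheory Set
open scoped ENNReal NNReal

noncomputable section

/-- A distortion function: `h : [0,1] → [0,1]` (measurable, not necessarily monotone) with
`h 0 = 0`. Only the values of `h` on `[0,1]` matter. -/
structure IsDistortion (h : ℝ → ℝ) : Prop where
  zero : h 0 = 0
  mapsTo : ∀ u ∈ Icc (0 : ℝ) 1, h u ∈ Icc (0 : ℝ) 1
  meas : Measurable (fun u : Icc (0 : ℝ) 1 => h u)

/-- The distortion riskmetric of a distribution `Q` on the line: the signed Choquet integral
`∫_{-∞}^0 (h(1 - Q(x)) - h(1)) dx + ∫_0^∞ h(1 - Q(x)) dx`. -/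
def distortionRisk (h : ℝ → ℝ) (Q : Measure ℝ) : ℝ :=
  (∫ x in Iic (0 : ℝ), (h (1 - cdf Q x) - h 1)) + ∫ x in Ioi (0 : ℝ), h (1 - cdf Q x)

/-- The probability measures on the reward space `S ⊆ ℝ` with finite first moment. -/
def FiniteMean (S : Set ℝ) : Set (Measure ℝ) :=
  {μ | IsProbabilityMeasure μ ∧ μ Sᶜ = 0 ∧ Integrable (fun x : ℝ => x) μ}

/-- The 1-Wasserstein distance: infimum of the transport cost over all couplings. -/
def wasserstein (μ ν : Measure ℝ) : ℝ≥0∞ :=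
  ⨅ (γ : Measure (ℝ × ℝ)) (_ : γ.map Prod.fst = μ ∧ γ.map Prod.snd = ν),
    ∫⁻ p, edist p.1 p.2 ∂γ

section Arms

variable {K : ℕ}

/-- The mixture `∑ i, α(i) F_i`. -/
def mixture (α : Fin K → ℝ) (F : Fin K → Measure ℝ) : Measure ℝ :=
  ∑ i, ENNReal.ofReal (α i) • F i

/-- The convex hull of the arm distributions. -/
def armHull (F : Fin K → Measure ℝ) : Set (Measure ℝ) :=
  {G | ∃ α ∈ stdSimplex ℝ (Fin K), G = mixture α F}

/-- `V(α, F)`: the riskmetric of the mixture with coefficients `α`. -/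
def mixValue (h : ℝ → ℝ) (F : Fin K → Measure ℝ) (α : Fin K → ℝ) : ℝ :=
  distortionRisk h (mixture α F)

/-- Hölder continuity of the riskmetric with exponent `q` and constant `L`, in the Wasserstein
metric, between mixtures of the arms and distributions on `S` with finite mean. The field `finite`
says that the riskmetric is a genuine (finite) integral. -/
structure IsHolderRisk (h : ℝ → ℝ) (S : Set ℝ) (F : Fin K → Measure ℝ) (q L : ℝ) : Prop where
  finite : ∀ G ∈ FiniteMean S, IntegrableOn (fun x => h (1 - cdf G x)) (Ioi 0)
  holder : ∀ G₁ ∈ armHull F, ∀ G₂ ∈ FiniteMean S,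
    |distortionRisk h G₁ - distortionRisk h G₂| ≤ L * (wasserstein G₁ G₂).toReal ^ q

/-- The constant `W`: the largest ratio between the Wasserstein distance of two mixtures of the
arms and the `ℓ₁` distance of their coefficients. -/
def mixRatio (F : Fin K → Measure ℝ) : ℝ :=
  sSup {x | ∃ α ∈ stdSimplex ℝ (Fin K), ∃ β ∈ stdSimplex ℝ (Fin K), α ≠ β ∧
    x = (1 / ∑ i, |α i - β i|) * (wasserstein (mixture α F) (mixture β F)).toReal}

variable (K) in
/-- The discretized simplex: every coordinate is the midpoint `ε (n + 1/2)` of an interval of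
length `ε`, except that the last one takes up the remainder when such midpoints do not add up
to `1` (it is still at least `ε/2`). -/
def discreteSimplex (ε : ℝ) : Set (Fin K → ℝ) :=
  {a | (∀ i : Fin K, (i : ℕ) + 1 < K → ∃ n : ℕ, a i = ε * (n + 1 / 2)) ∧
    (∀ i, ε / 2 ≤ a i) ∧ ∑ i, a i = 1}

/-- The maximizers of `f` over `D`. -/
def argmaxOn {β : Type*} (f : β → ℝ) (D : Set β) : Set β :=
  {a | a ∈ D ∧ ∀ b ∈ D, f b ≤ f a}

/-- The minimum suboptimality gap `min {V(a⋆) - V(a) : a ≠ a⋆}` over the discretized simplex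
(the minimum of the empty set is `∞`). -/
def minGap (h : ℝ → ℝ) (F : Fin K → Measure ℝ) (ε : ℝ) (astar : Fin K → ℝ) : ℝ≥0∞ :=
  ⨅ a ∈ {a | a ∈ discreteSimplex K ε ∧ a ≠ astar},
    ENNReal.ofReal (mixValue h F astar - mixValue h F a)

/-- The set of times `s ≥ 1` with
`(√(2e log s) + 32) / √(ρ s ε / 4) ≤ (1/16) (Δ_min / (2 K L))^(1/q)`, for a gap `Δ_min = gap`. -/
def goodTimes (K : ℕ) (gap : ℝ≥0∞) (L q ρ ε : ℝ) : Set ℕ :=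
  {s | 1 ≤ s ∧
    ENNReal.ofReal ((√(2 * Real.exp 1 * Real.log s) + 32) / √(ρ / 4 * s * ε)) ≤
      (1 / 16) * (gap / ENNReal.ofReal (2 * K * L)) ^ (1 / q)}

/-- `T₀`, the first time `t ≥ 1` from which on all times are in `goodTimes` (`∞` if none). -/
def burnIn (K : ℕ) (gap : ℝ≥0∞) (L q ρ ε : ℝ) : ℕ∞ :=
  ⨅ t ∈ {t : ℕ | 1 ≤ t ∧ ∀ s ≥ t, s ∈ goodTimes K gap L q ρ ε}, (t : ℕ∞)

/-- `T(ε) = (2/ε) (T₀ - 1)`. -/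
def horizonThreshold (K : ℕ) (gap : ℝ≥0∞) (L q ρ ε : ℝ) : ℝ≥0∞ :=
  ENNReal.ofReal (2 / ε) * ((burnIn K gap L q ρ ε : ℝ≥0∞) - 1)

section Trajectories

variable {Ω : Type*}

/-- Number of times that arm `i` is selected in the first `t` rounds. Rounds are numbered from `0`:
`A s` is the arm selected in round `s` and `X s` is the reward of that round. -/
def pullCount (A : ℕ → Ω → Fin K) (t : ℕ) (i : Fin K) (ω : Ω) : ℕ :=
  ((Finset.range t).filter (fun s => A s ω = i)).card

/-- Empirical distribution of the rewards of arm `i` in the first `t` rounds. -/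
def empiricalDist (A : ℕ → Ω → Fin K) (X : ℕ → Ω → ℝ) (t : ℕ) (i : Fin K) (ω : Ω) : Measure ℝ :=
  ((pullCount A t i ω : ℝ≥0∞))⁻¹ •
    ∑ s ∈ (Finset.range t).filter (fun s => A s ω = i), Measure.dirac (X s ω)

/-- Confidence radius of an arm with `n` samples at horizon `T`. -/
def confRadius (T n : ℕ) : ℝ :=
  16 * ((√(2 * Real.exp 1 * Real.log T) + 32) / √n)

/-- Distribution confidence space of arm `i` after `t` rounds. -/
def confSet (S : Set ℝ) (T : ℕ) (A : ℕ → Ω → Fin K) (X : ℕ → Ω → ℝ) (t : ℕ) (i : Fin K) (ω : Ω) :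
    Set (Measure ℝ) :=
  {η | η ∈ FiniteMean S ∧
    wasserstein (empiricalDist A X t i ω) η ≤ ENNReal.ofReal (confRadius T (pullCount A t i ω))}

/-- Optimistic index used by RS-UCB-M: the best value of the mixture over all choices of
distributions in the confidence spaces. -/
def rsIndex (h : ℝ → ℝ) (S : Set ℝ) (T : ℕ) (A : ℕ → Ω → Fin K) (X : ℕ → Ω → ℝ)
    (t : ℕ) (ω : Ω) (a : Fin K → ℝ) : ℝ :=
  sSup {v | ∃ η : Fin K → Measure ℝ, (∀ i, η i ∈ confSet S T A X t i ω) ∧ v = mixValue h η a}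

/-- Index used by CE-UCB-M: plug-in value plus an explicit bonus. -/
def ceIndex (h : ℝ → ℝ) (q L : ℝ) (T : ℕ) (A : ℕ → Ω → Fin K) (X : ℕ → Ω → ℝ)
    (t : ℕ) (ω : Ω) (a : Fin K → ℝ) : ℝ :=
  mixValue h (fun i => empiricalDist A X t i ω) a +
    L * ∑ i, (a i * confRadius T (pullCount A t i ω)) ^ q

variable {mΩ : MeasurableSpace Ω}

/-- Interaction of a (possibly randomized) policy with the bandit instance `F` over `T` rounds.
`ℱ t` is the information available when the reward of round `t` is generated: all earlier arms and
rewards, the arm `A t`, and any internal randomization of the policy. Given `ℱ t`, the reward `X t`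
has distribution `F (A t)`. -/
structure IsBanditRun (P : Measure Ω) (F : Fin K → Measure ℝ) (T : ℕ)
    (ℱ : Filtration ℕ mΩ)
    (A : ℕ → Ω → Fin K) (X : ℕ → Ω → ℝ) : Prop where
  action_meas : ∀ t < T, Measurable[ℱ t] (A t)
  reward_meas : ∀ t < T, Measurable[ℱ (t + 1)] (X t)
  reward_law : ∀ t < T, ∀ E : Set ℝ, MeasurableSet E →
    P[(X t ⁻¹' E).indicator (fun _ => (1 : ℝ)) | ℱ t] =ᵐ[P] fun ω => (F (A t ω)).real E

/-- Length per arm of the forced exploration. -/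
def exploreCount (ρ ε : ℝ) (T : ℕ) : ℕ := ⌈ρ * T * ε / 4⌉₊

/-- The arms `A` are selected by the mixture-tracking algorithm with a given index:
* each arm is sampled `N = ⌈ρ T ε / 4⌉` times in the first `K N` rounds (for instance in a
  round-robin fashion);
* afterwards `a t` maximizes the index over the discretized simplex, and the previous maximizer is
  kept as long as it remains one (other ties are broken arbitrarily);
* the next arm is the most under-sampled one: it maximizes `t a_t(i) - τ_t(i)`. -/
structure FollowsUCB (P : Measure Ω) (ρ ε : ℝ) (T : ℕ) (index : ℕ → Ω → (Fin K → ℝ) → ℝ)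
    (A : ℕ → Ω → Fin K) (a : ℕ → Ω → Fin K → ℝ) : Prop where
  explore : ∀ᵐ ω ∂P, ∀ i, pullCount A (K * exploreCount ρ ε T) i ω = exploreCount ρ ε T
  optimistic : ∀ᵐ ω ∂P, ∀ t, K * exploreCount ρ ε T ≤ t → t < T →
    a t ω ∈ argmaxOn (index t ω) (discreteSimplex K ε)
  keep : ∀ᵐ ω ∂P, ∀ t, K * exploreCount ρ ε T ≤ t → t + 1 < T →
    a t ω ∈ argmaxOn (index (t + 1) ω) (discreteSimplex K ε) → a (t + 1) ω = a t ω
  track : ∀ᵐ ω ∂P, ∀ t, K * exploreCount ρ ε T ≤ t → t < T →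
    A t ω ∈ argmaxOn (fun i => (t : ℝ) * a t ω i - pullCount A t i ω) univ

/-- Regret at horizon `T`: optimal mixture value minus the expected riskmetric of the mixture given
by the arm-selection frequencies. -/
def regret (P : Measure Ω) (h : ℝ → ℝ) (F : Fin K → Measure ℝ) (αstar : Fin K → ℝ) (T : ℕ)
    (A : ℕ → Ω → Fin K) : ℝ :=
  mixValue h F αstar - ∫ ω, mixValue h F (fun i => (1 / T : ℝ) * pullCount A T i ω) ∂P

end Trajectories

end Arms

end

/-! With high probability the index identifies the best discretized mixture `astar` at every round
after the forced exploration. From then on, tracking a fixed target brings the frequencies within `2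
K / T` of it in `ℓ₁`, and Hölder continuity turns this into a loss of value.

Concentration. On the line the Wasserstein distance is the `L¹` distance of the distribution
functions, so `n` times the distance of an empirical distribution from its source is a function of
the sample that is 1-Lipschitz in `ℓ₁`. Its mean is at most `4√n`, and it has sub-Gaussian
deviations by tensorization (`lintegral_exp_lipschitz_pi_le`, `measure_sampleDev_gt_le`). The
samples of an arm are collected adaptively; a martingale argument
(`IsBanditRun.measure_rewardRecord_le`) dominates them by independent ones, and a union bound gives
a bad event of probability at most `K / T ^ 2`.

Optimism. Off the bad event each index lies between the true value of a mixture and that value plus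
`2 L ∑ (a i c i) ^ q` (`IsHolderRisk.plugin_bounds`, `IsHolderRisk.sSup_bounds`). Forced exploration
makes the radii so small, beyond the horizon threshold, that this surplus is below the minimum gap,
so the only possible maximizer is `astar` (`eq_of_optimism`).

Tracking. An arm is pulled only while it is not ahead of its target, which bounds every count from
above by the target plus one (`pullCount_le_of_tracking`); since all counts add up to `T`, the
two-sided bound follows.

Let `R` be the base of the power in the final bound. If `R ≥ 1` the bound is trivial, since values
lie in `[0, B]`. Otherwise the loss is at most `L W ^ q R ^ q` off the bad event and at most `B` on
it, and the probability of the bad event is at most `R ^ q`. -/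

/-! ### Wasserstein distance on the line as the `L¹` distance of distribution functions. -/

section Wasserstein

/-- The distribution function of a point mass at `a`. -/
noncomputable def stepAt (a x : ℝ) : ℝ := if a ≤ x then 1 else 0

theorem measurable_stepAt : Measurable (fun p : ℝ × ℝ => stepAt p.1 p.2) :=
  Measurable.ite (measurableSet_le measurable_fst measurable_snd) measurable_const measurable_const

theorem Measurable.stepAt {β : Type*} [MeasurableSpace β] {f g : β → ℝ} (hf : Measurable f)
    (hg : Measurable g) : Measurable (fun b => stepAt (f b) (g b)) :=
  measurable_stepAt.comp (hf.prodMk hg)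

theorem stepAt_nonneg (a x : ℝ) : 0 ≤ stepAt a x := by
  unfold _root_.stepAt; split_ifs <;> norm_num

theorem stepAt_le_one (a x : ℝ) : stepAt a x ≤ 1 := by
  unfold _root_.stepAt; split_ifs <;> norm_num

/-- The two steps differ exactly on the interval between `a` and `b`. Writing a distance as an
integral over levels `x` lets Tonelli exchange transport costs with integrals of distribution
functions. -/
theorem lintegral_abs_stepAt_sub (a b : ℝ) :
    ∫⁻ x, ENNReal.ofReal |stepAt a x - stepAt b x| = edist a b := by
  have h : ∀ x, ENNReal.ofReal |stepAt a x - stepAt b x| =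
      (Ico (min a b) (max a b)).indicator 1 x := by
    intro x
    unfold stepAt
    by_cases h1 : a ≤ x <;> by_cases h2 : b ≤ x <;>
      simp [h1, h2, indicator, not_lt.2, lt_of_not_ge]
  simp_rw [h]
  rw [lintegral_indicator_one measurableSet_Ico, Real.volume_Ico, max_sub_min_eq_abs,
    edist_dist, Real.dist_eq, abs_sub_comm]

theorem integrable_stepAt {β : Type*} [MeasurableSpace β] {μ : Measure β} [IsFiniteMeasure μ]
    {f : β → ℝ} (hf : Measurable f) (x : ℝ) : Integrable (fun b => stepAt (f b) x) μ :=
  Integrable.of_bound (hf.stepAt measurable_const).aestronglyMeasurable 1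
    (Filter.Eventually.of_forall fun b => by
      rw [Real.norm_eq_abs, abs_of_nonneg (stepAt_nonneg _ _)]; exact stepAt_le_one _ _)

theorem integral_stepAt (μ : Measure ℝ) [IsProbabilityMeasure μ] (x : ℝ) :
    ∫ y, stepAt y x ∂μ = cdf μ x := by
  rw [cdf_eq_real, ← integral_indicator_one measurableSet_Iic]
  rfl

/-- The `L¹` distance of the distribution functions. -/
noncomputable def cdfDist (μ ν : Measure ℝ) : ℝ≥0∞ := ∫⁻ x, ENNReal.ofReal |cdf μ x - cdf ν x|

theorem measurable_cdf (μ : Measure ℝ) : Measurable (cdf μ) := (monotone_cdf μ).measurable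

theorem cdfDist_comm (μ ν : Measure ℝ) : cdfDist μ ν = cdfDist ν μ := by
  unfold cdfDist; simp_rw [abs_sub_comm]

theorem cdfDist_triangle (μ ν η : Measure ℝ) : cdfDist μ η ≤ cdfDist μ ν + cdfDist ν η := by
  unfold cdfDist
  rw [← lintegral_add_left]
  · refine lintegral_mono fun x => ?_
    rw [← ENNReal.ofReal_add (abs_nonneg _) (abs_nonneg _)]
    exact ENNReal.ofReal_le_ofReal (abs_sub_le _ _ _)
  · exact ((measurable_cdf μ).sub (measurable_cdf ν)).abs.ennreal_ofReal

/-- At each level `x` the two distribution functions are means of step functions under the coupling,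
so the triangle inequality for the integral applies level by level. -/
theorem cdfDist_le_of_coupling {μ ν : Measure ℝ} [IsProbabilityMeasure μ] [IsProbabilityMeasure ν]
    {γ : Measure (ℝ × ℝ)} (h1 : γ.map Prod.fst = μ) (h2 : γ.map Prod.snd = ν) :
    cdfDist μ ν ≤ ∫⁻ p, edist p.1 p.2 ∂γ := by
  have hγ : IsProbabilityMeasure γ := by
    refine ⟨?_⟩
    have : (γ.map Prod.fst) univ = 1 := by rw [h1]; exact measure_univ
    rwa [Measure.map_apply measurable_fst MeasurableSet.univ] at this
  simp_rw [← lintegral_abs_stepAt_sub]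
  rw [lintegral_lintegral_swap]
  · refine lintegral_mono fun x => ?_
    have e1 : cdf μ x = ∫ p, stepAt p.1 x ∂γ := by
      rw [← integral_stepAt, ← h1, integral_map measurable_fst.aemeasurable]
      exact (measurable_id.stepAt measurable_const).aestronglyMeasurable
    have e2 : cdf ν x = ∫ p, stepAt p.2 x ∂γ := by
      rw [← integral_stepAt, ← h2, integral_map measurable_snd.aemeasurable]
      exact (measurable_id.stepAt measurable_const).aestronglyMeasurable
    rw [e1, e2, ← integral_sub (integrable_stepAt measurable_fst x)
      (integrable_stepAt measurable_snd x)]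
    have := enorm_integral_le_lintegral_enorm (μ := γ) (fun p => stepAt p.1 x - stepAt p.2 x)
    simpa [Real.enorm_eq_ofReal_abs] using this
  · refine Measurable.aemeasurable ?_
    exact (((measurable_fst.comp measurable_fst).stepAt measurable_snd).sub
      ((measurable_snd.comp measurable_fst).stepAt measurable_snd)).abs.ennreal_ofReal

theorem cdfDist_le_wasserstein (μ ν : Measure ℝ) [IsProbabilityMeasure μ]
    [IsProbabilityMeasure ν] : cdfDist μ ν ≤ wasserstein μ ν :=
  le_iInf₂ fun _ h => cdfDist_le_of_coupling h.1 h.2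

/-- The quantile function, set to `0` outside of `(0, 1)`. -/
noncomputable def quantile (μ : Measure ℝ) (u : ℝ) : ℝ :=
  if u ∈ Ioo (0 : ℝ) 1 then sInf {x | u ≤ cdf μ x} else 0

/-- Right continuity of the distribution function puts the infimum into the set; this is the Galois
connection behind inverse transform sampling. -/
theorem quantile_le_iff (μ : Measure ℝ) {u : ℝ} (hu : u ∈ Ioo (0 : ℝ) 1)
    (x : ℝ) : quantile μ u ≤ x ↔ u ≤ cdf μ x := by
  have hne : {x | u ≤ cdf μ x}.Nonempty :=
    (((tendsto_cdf_atTop μ).eventually (lt_mem_nhds hu.2)).exists).imp fun _ h => le_of_lt h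
  obtain ⟨b, hb⟩ := ((tendsto_cdf_atBot μ).eventually (gt_mem_nhds hu.1)).exists
  have hbdd : BddBelow {x | u ≤ cdf μ x} := by
    refine ⟨b, fun y hy => ?_⟩
    by_contra hlt
    exact absurd (hy.trans (monotone_cdf μ (not_le.1 hlt).le)) (not_le.2 hb)
  rw [quantile, if_pos hu]
  refine ⟨fun h => ?_, fun h => csInf_le hbdd h⟩
  have key : ∀ y > x, u ≤ cdf μ y := by
    intro y hy
    obtain ⟨z, hz, hzy⟩ := (csInf_lt_iff hbdd hne).1 (lt_of_le_of_lt h hy)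
    exact le_trans hz (monotone_cdf μ hzy.le)
  have hc : Filter.Tendsto (cdf μ) (nhdsWithin x (Ioi x)) (nhds (cdf μ x)) :=
    ((cdf μ).right_continuous x).mono_left (nhdsWithin_mono x Ioi_subset_Ici_self)
  exact ge_of_tendsto hc (by filter_upwards [self_mem_nhdsWithin] with y hy using key y hy)

theorem measurable_quantile (μ : Measure ℝ) : Measurable (quantile μ) := by
  refine measurable_of_Iic fun x => ?_
  have : quantile μ ⁻¹' Iic x =
      (Ioo (0 : ℝ) 1 ∩ Iic (cdf μ x)) ∪ ((Ioo (0 : ℝ) 1)ᶜ ∩ {_u | (0 : ℝ) ≤ x}) := by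
    ext u
    by_cases hu : u ∈ Ioo (0 : ℝ) 1
    · simp only [mem_preimage, mem_Iic, quantile_le_iff μ hu, mem_union, mem_inter_iff, hu,
        mem_compl_iff, not_true_eq_false, true_and, false_and, or_false]
    · simp only [mem_preimage, mem_Iic, mem_union, mem_inter_iff, hu, quantile, if_false,
        mem_compl_iff, not_false_eq_true, true_and, false_and, false_or, mem_ofPred_eq]
  rw [this]
  exact (measurableSet_Ioo.inter measurableSet_Iic).union
    (measurableSet_Ioo.compl.inter (MeasurableSet.const _))

theorem map_quantile (μ : Measure ℝ) [IsProbabilityMeasure μ] :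
    (volume.restrict (Ioo (0 : ℝ) 1)).map (quantile μ) = μ := by
  have : IsProbabilityMeasure (volume.restrict (Ioo (0 : ℝ) 1)) := ⟨by simp⟩
  refine Measure.ext_of_Iic _ _ fun x => ?_
  rw [Measure.map_apply (measurable_quantile μ) measurableSet_Iic, Measure.restrict_apply
    (measurable_quantile μ measurableSet_Iic), ← ofReal_cdf]
  have : quantile μ ⁻¹' Iic x ∩ Ioo 0 1 = Ioo 0 1 ∩ Iic (cdf μ x) := by
    ext u
    constructor
    · rintro ⟨h1, h2⟩
      exact ⟨h2, (quantile_le_iff μ h2 x).1 h1⟩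
    · rintro ⟨h1, h2⟩
      exact ⟨(quantile_le_iff μ h1 x).2 h2, h1⟩
  rw [this]
  apply le_antisymm
  · calc volume (Ioo 0 1 ∩ Iic (cdf μ x)) ≤ volume (Ioc 0 (cdf μ x)) :=
        measure_mono fun u (hu : u ∈ Ioo 0 1 ∩ Iic (cdf μ x)) => ⟨hu.1.1, hu.2⟩
      _ = _ := by rw [Real.volume_Ioc, sub_zero]
  · calc ENNReal.ofReal (cdf μ x) = volume (Ioo 0 (cdf μ x)) := by rw [Real.volume_Ioo, sub_zero]
      _ ≤ volume (Ioo 0 1 ∩ Iic (cdf μ x)) := measure_mono fun u hu => ⟨⟨hu.1, hu.2.trans_le (cdf_le_one μ x)⟩, hu.2.le⟩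

/-- The monotone coupling, given by both quantile functions of one uniform variable `u`, attains the
bound: at level `x` the steps differ only when `u` lies between the two values of the distribution
functions. -/
theorem wasserstein_le_cdfDist (μ ν : Measure ℝ) [IsProbabilityMeasure μ]
    [IsProbabilityMeasure ν] : wasserstein μ ν ≤ cdfDist μ ν := by
  have hm : Measurable fun u => (quantile μ u, quantile ν u) :=
    (measurable_quantile μ).prodMk (measurable_quantile ν)
  have hγ : ((volume.restrict (Ioo (0 : ℝ) 1)).map fun u => (quantile μ u, quantile ν u)).map
        Prod.fst = μ ∧
      ((volume.restrict (Ioo (0 : ℝ) 1)).map fun u => (quantile μ u, quantile ν u)).map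
        Prod.snd = ν := by
    constructor
    · rw [Measure.map_map measurable_fst hm]; exact map_quantile μ
    · rw [Measure.map_map measurable_snd hm]; exact map_quantile ν
  have hle : wasserstein μ ν ≤ ∫⁻ p : ℝ × ℝ, edist p.1 p.2
      ∂((volume.restrict (Ioo (0 : ℝ) 1)).map fun u => (quantile μ u, quantile ν u)) :=
    iInf₂_le (f := fun (γ : Measure (ℝ × ℝ)) (_ : γ.map Prod.fst = μ ∧ γ.map Prod.snd = ν) =>
      ∫⁻ p, edist p.1 p.2 ∂γ) _ hγ
  refine hle.trans ?_
  rw [lintegral_map (measurable_fst.edist measurable_snd) hm]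
  simp_rw [← lintegral_abs_stepAt_sub]
  rw [lintegral_lintegral_swap]
  · refine lintegral_mono fun x => ?_
    calc ∫⁻ u in Ioo (0 : ℝ) 1, ENNReal.ofReal
          |stepAt (quantile μ u) x - stepAt (quantile ν u) x|
        ≤ ∫⁻ u in Ioo (0 : ℝ) 1,
          (Ioc (min (cdf μ x) (cdf ν x)) (max (cdf μ x) (cdf ν x))).indicator 1 u := by
          refine setLIntegral_mono' measurableSet_Ioo fun u hu => ?_
          unfold stepAt
          simp only [quantile_le_iff μ hu, quantile_le_iff ν hu]
          by_cases h1 : u ≤ cdf μ x <;> by_cases h2 : u ≤ cdf ν x <;>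
            simp [h1, h2, indicator, lt_of_not_ge]
      _ ≤ ∫⁻ u, (Ioc (min (cdf μ x) (cdf ν x)) (max (cdf μ x) (cdf ν x))).indicator 1 u :=
          setLIntegral_le_lintegral _ _
      _ = ENNReal.ofReal |cdf μ x - cdf ν x| := by
          rw [lintegral_indicator_one measurableSet_Ioc, Real.volume_Ioc, max_sub_min_eq_abs,
            abs_sub_comm]
  · refine Measurable.aemeasurable ?_
    exact ((((measurable_quantile μ).comp measurable_fst).stepAt measurable_snd).sub
      (((measurable_quantile ν).comp measurable_fst).stepAt measurable_snd)).abs.ennreal_ofReal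

theorem cdfDist_lt_top {S : Set ℝ} {μ ν : Measure ℝ} (hμ : μ ∈ FiniteMean S)
    (hν : ν ∈ FiniteMean S) : cdfDist μ ν < ⊤ := by
  have := hμ.1
  have := hν.1
  refine (cdfDist_le_of_coupling (γ := μ.prod ν) ?_ ?_).trans_lt ?_
  · rw [Measure.map_fst_prod]; simp
  · rw [Measure.map_snd_prod]; simp
  · calc ∫⁻ p, edist p.1 p.2 ∂(μ.prod ν) ≤ ∫⁻ p, (‖p.1‖ₑ + ‖p.2‖ₑ) ∂(μ.prod ν) :=
          lintegral_mono fun p => by rw [edist_eq_enorm_sub]; exact enorm_sub_le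
      _ = ∫⁻ p, ‖p.1‖ₑ ∂(μ.prod ν) + ∫⁻ p, ‖p.2‖ₑ ∂(μ.prod ν) :=
          lintegral_add_left measurable_fst.enorm _
      _ < ⊤ := ENNReal.add_lt_top.2 ⟨(hμ.2.2.comp_fst ν).2, (hν.2.2.comp_snd μ).2⟩

end Wasserstein

/-! ### Mixtures of the arms and the constant `W`. -/

section Mixtures

variable {K : ℕ}

theorem mixture_apply (α : Fin K → ℝ) (F : Fin K → Measure ℝ) (E : Set ℝ) :
    mixture α F E = ∑ i, ENNReal.ofReal (α i) * F i E := by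
  simp [mixture, Measure.finsetSum_apply]

theorem mixture_mem_finiteMean {S : Set ℝ} {α : Fin K → ℝ} (hα : α ∈ stdSimplex ℝ (Fin K))
    {F : Fin K → Measure ℝ} (hF : ∀ i, F i ∈ FiniteMean S) : mixture α F ∈ FiniteMean S := by
  refine ⟨⟨?_⟩, ?_, ?_⟩
  · rw [mixture_apply]
    have : ∀ i, F i univ = 1 := fun i => (hF i).1.measure_univ
    simp_rw [this, mul_one]
    rw [← ENNReal.ofReal_sum_of_nonneg fun i _ => hα.1 i, hα.2, ENNReal.ofReal_one]
  · rw [mixture_apply]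
    exact Finset.sum_eq_zero fun i _ => by rw [(hF i).2.1, mul_zero]
  · unfold mixture
    refine integrable_finsetSum_measure.2 fun i _ => ?_
    exact (hF i).2.2.smul_measure ENNReal.ofReal_ne_top

theorem cdf_mixture {α : Fin K → ℝ} (hα : α ∈ stdSimplex ℝ (Fin K))
    {F : Fin K → Measure ℝ} (hF : ∀ i, IsProbabilityMeasure (F i)) (x : ℝ) :
    cdf (mixture α F) x = ∑ i, α i * cdf (F i) x := by
  have : IsProbabilityMeasure (mixture α F) := by
    refine ⟨?_⟩
    rw [mixture_apply]
    simp_rw [measure_univ, mul_one]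
    rw [← ENNReal.ofReal_sum_of_nonneg fun i _ => hα.1 i, hα.2, ENNReal.ofReal_one]
  simp_rw [cdf_eq_real, measureReal_def, mixture_apply]
  rw [ENNReal.toReal_sum fun i _ => ENNReal.mul_ne_top ENNReal.ofReal_ne_top (measure_ne_top _ _)]
  refine Finset.sum_congr rfl fun i _ => ?_
  rw [ENNReal.toReal_mul, ENNReal.toReal_ofReal (hα.1 i)]

theorem cdfDist_mixture_le {α : Fin K → ℝ} (hα : α ∈ stdSimplex ℝ (Fin K))
    {F G : Fin K → Measure ℝ} (hF : ∀ i, IsProbabilityMeasure (F i))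
    (hG : ∀ i, IsProbabilityMeasure (G i)) :
    cdfDist (mixture α F) (mixture α G) ≤ ∑ i, ENNReal.ofReal (α i) * cdfDist (F i) (G i) := by
  unfold cdfDist
  simp_rw [cdf_mixture hα hF, cdf_mixture hα hG]
  have hm : ∀ i, Measurable fun x => ENNReal.ofReal |cdf (F i) x - cdf (G i) x| := fun i =>
    ((measurable_cdf (F i)).sub (measurable_cdf (G i))).abs.ennreal_ofReal
  simp_rw [← lintegral_const_mul _ (hm _)]
  rw [← lintegral_finsetSum _ fun i _ => (hm i).const_mul _]
  refine lintegral_mono fun x => ?_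
  simp_rw [← ENNReal.ofReal_mul (hα.1 _)]
  rw [← ENNReal.ofReal_sum_of_nonneg fun i _ => mul_nonneg (hα.1 i) (abs_nonneg _)]
  refine ENNReal.ofReal_le_ofReal ?_
  rw [← Finset.sum_sub_distrib]
  refine (Finset.abs_sum_le_sum_abs _ _).trans (Finset.sum_le_sum fun i _ => ?_)
  rw [← mul_sub, abs_mul, abs_of_nonneg (hα.1 i)]

/-- The differences `α i - β i` add up to zero, so a common reference `cdf G` may be subtracted from
every `cdf (F i)`; only these differences have a chance of being integrable over the line. -/
theorem cdfDist_mixture_mixture_le {α β : Fin K → ℝ} (hα : α ∈ stdSimplex ℝ (Fin K))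
    (hβ : β ∈ stdSimplex ℝ (Fin K)) {F : Fin K → Measure ℝ}
    (hF : ∀ i, IsProbabilityMeasure (F i)) (G : Measure ℝ) :
    cdfDist (mixture α F) (mixture β F) ≤
      ENNReal.ofReal (∑ i, |α i - β i|) * ∑ i, cdfDist (F i) G := by
  unfold cdfDist
  simp_rw [cdf_mixture hα hF, cdf_mixture hβ hF]
  have hm : ∀ i, Measurable fun x => ENNReal.ofReal |cdf (F i) x - cdf G x| := fun i =>
    ((measurable_cdf (F i)).sub (measurable_cdf G)).abs.ennreal_ofReal
  rw [← lintegral_finsetSum _ fun i _ => hm i,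
    ← lintegral_const_mul _ (Finset.measurable_sum _ fun i _ => hm i)]
  refine lintegral_mono fun x => ?_
  dsimp only
  rw [← ENNReal.ofReal_sum_of_nonneg fun i _ => abs_nonneg _,
    ← ENNReal.ofReal_mul (Finset.sum_nonneg fun i _ => abs_nonneg _)]
  refine ENNReal.ofReal_le_ofReal ?_
  have e : ∑ i, α i * cdf (F i) x - ∑ i, β i * cdf (F i) x =
      ∑ i, (α i - β i) * (cdf (F i) x - cdf G x) := by
    simp_rw [sub_mul, mul_sub, Finset.sum_sub_distrib, ← Finset.sum_mul, hα.2, hβ.2]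
    ring
  rw [e, Finset.sum_mul]
  refine (Finset.abs_sum_le_sum_abs _ _).trans (Finset.sum_le_sum fun i _ => ?_)
  rw [abs_mul]
  exact mul_le_mul_of_nonneg_left
    (Finset.single_le_sum (f := fun i => |cdf (F i) x - cdf G x|) (fun i _ => abs_nonneg _)
      (Finset.mem_univ i)) (abs_nonneg _)

theorem mixRatio_nonneg (F : Fin K → Measure ℝ) : 0 ≤ mixRatio F := by
  refine Real.sSup_nonneg ?_
  rintro x ⟨α, _, β, _, _, rfl⟩
  positivity

theorem wasserstein_mixture_le_mixRatio {S : Set ℝ} {F : Fin K → Measure ℝ}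
    (hF : ∀ i, F i ∈ FiniteMean S) {α β : Fin K → ℝ} (hα : α ∈ stdSimplex ℝ (Fin K))
    (hβ : β ∈ stdSimplex ℝ (Fin K)) :
    (wasserstein (mixture α F) (mixture β F)).toReal ≤ mixRatio F * ∑ i, |α i - β i| := by
  have hprob : ∀ i, IsProbabilityMeasure (F i) := fun i => (hF i).1
  rcases eq_or_ne α β with rfl | hne
  · have := (mixture_mem_finiteMean hα hF).1
    have : wasserstein (mixture α F) (mixture α F) ≤ 0 :=
      (wasserstein_le_cdfDist _ _).trans (by simp [cdfDist])
    simp [le_antisymm this zero_le]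
  obtain ⟨i₀, -⟩ := Function.ne_iff.1 hne
  set M : ℝ≥0∞ := ∑ i, cdfDist (F i) (F i₀) with hM
  have hMtop : M ≠ ⊤ := (ENNReal.sum_lt_top.2 fun i _ => cdfDist_lt_top (hF i) (hF i₀)).ne
  have hpos : ∀ {α β : Fin K → ℝ}, α ≠ β → 0 < ∑ i, |α i - β i| := by
    intro α β h
    obtain ⟨i, hi⟩ := Function.ne_iff.1 h
    exact Finset.sum_pos' (fun i _ => abs_nonneg _) ⟨i, Finset.mem_univ i, abs_pos.2 (sub_ne_zero.2 hi)⟩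
  -- The real `sSup` of an unbounded set is `0`, so without this bound `mixRatio` would not dominate
  -- any ratio.
  have hbdd : BddAbove {x | ∃ α ∈ stdSimplex ℝ (Fin K), ∃ β ∈ stdSimplex ℝ (Fin K), α ≠ β ∧
      x = (1 / ∑ i, |α i - β i|) * (wasserstein (mixture α F) (mixture β F)).toReal} := by
    refine ⟨M.toReal, ?_⟩
    rintro x ⟨α, hα, β, hβ, h, rfl⟩
    have := (mixture_mem_finiteMean hα hF).1
    have := (mixture_mem_finiteMean hβ hF).1
    rw [one_div, inv_mul_le_iff₀ (hpos h)]
    calc (wasserstein (mixture α F) (mixture β F)).toReal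
        ≤ (ENNReal.ofReal (∑ i, |α i - β i|) * M).toReal :=
          ENNReal.toReal_mono (ENNReal.mul_ne_top ENNReal.ofReal_ne_top hMtop)
            ((wasserstein_le_cdfDist _ _).trans (cdfDist_mixture_mixture_le hα hβ hprob _))
      _ = _ := by rw [ENNReal.toReal_mul, ENNReal.toReal_ofReal (hpos h).le]
  have := le_csSup hbdd ⟨α, hα, β, hβ, hne, rfl⟩
  rw [one_div, inv_mul_le_iff₀ (hpos hne)] at this
  rwa [mul_comm]

end Mixtures

/-! ### Exponential moments of Lipschitz functions of independent samples. -/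

section Concentration

/-- Twice such a product is the double integral of `2 cosh (w x - w y)` over two independent copies,
and `cosh` increases with the absolute value of its argument. -/
theorem lintegral_exp_mul_lintegral_exp_neg_le {β : Type*} [MeasurableSpace β] (ν : Measure β)
    [SFinite ν] {w v : β → ℝ} (hw : Measurable w) (hv : Measurable v)
    (hwv : ∀ x y, |w x - w y| ≤ |v x - v y|) :
    (∫⁻ x, ENNReal.ofReal (Real.exp (w x)) ∂ν) * ∫⁻ x, ENNReal.ofReal (Real.exp (-w x)) ∂ν ≤
      (∫⁻ x, ENNReal.ofReal (Real.exp (v x)) ∂ν) * ∫⁻ x, ENNReal.ofReal (Real.exp (-v x)) ∂ν := by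
  have key : ∀ {f : β → ℝ}, Measurable f →
      2 * ((∫⁻ x, ENNReal.ofReal (Real.exp (f x)) ∂ν) *
        ∫⁻ x, ENNReal.ofReal (Real.exp (-f x)) ∂ν) =
      ∫⁻ x, ∫⁻ y, ENNReal.ofReal (2 * Real.cosh (f x - f y)) ∂ν ∂ν := by
    intro f hf
    have m1 : Measurable fun x => ENNReal.ofReal (Real.exp (f x)) := by fun_prop
    have m2 : Measurable fun x => ENNReal.ofReal (Real.exp (-f x)) := by fun_prop
    have e : ∀ x y, ENNReal.ofReal (2 * Real.cosh (f x - f y)) =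
        ENNReal.ofReal (Real.exp (f x)) * ENNReal.ofReal (Real.exp (-f y)) +
        ENNReal.ofReal (Real.exp (-f x)) * ENNReal.ofReal (Real.exp (f y)) := by
      intro x y
      rw [← ENNReal.ofReal_mul (Real.exp_nonneg _), ← ENNReal.ofReal_mul (Real.exp_nonneg _),
        ← ENNReal.ofReal_add (by positivity) (by positivity), ← Real.exp_add, ← Real.exp_add,
        Real.cosh_eq]
      congr 1
      ring_nf
    simp_rw [e]
    have m3 : ∀ x, Measurable fun y => ENNReal.ofReal (Real.exp (f x)) *
        ENNReal.ofReal (Real.exp (-f y)) := fun x => by fun_prop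
    simp_rw [lintegral_add_left (m3 _)]
    rw [lintegral_add_left, lintegral_lintegral_mul m1.aemeasurable m2.aemeasurable,
      lintegral_lintegral_mul m2.aemeasurable m1.aemeasurable]
    · ring
    · simp_rw [lintegral_const_mul _ m2]
      exact m1.mul_const _
  have h2 : 2 * ((∫⁻ x, ENNReal.ofReal (Real.exp (w x)) ∂ν) *
        ∫⁻ x, ENNReal.ofReal (Real.exp (-w x)) ∂ν) ≤
      2 * ((∫⁻ x, ENNReal.ofReal (Real.exp (v x)) ∂ν) *
        ∫⁻ x, ENNReal.ofReal (Real.exp (-v x)) ∂ν) := by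
    rw [key hw, key hv]
    exact lintegral_mono fun x => lintegral_mono fun y =>
      ENNReal.ofReal_le_ofReal (mul_le_mul_of_nonneg_left (Real.cosh_le_cosh.2 (hwv x y)) zero_le_two)
  exact (ENNReal.mul_le_mul_iff_right two_ne_zero ENNReal.ofNat_ne_top).1 h2

/-- By Jensen the factor with the opposite sign is at least one and can be inserted; the resulting
product is compared with that of the identity function. Each sign costs `l ^ 2 / 2`, which is why
the exponent is `l ^ 2`. -/
theorem lintegral_exp_lipschitz_le {ν : Measure ℝ} [IsProbabilityMeasure ν]
    (hint : Integrable (fun x : ℝ => x) ν) {m : ℝ} (hsub : HasSubgaussianMGF (fun x : ℝ => x - m) 1 ν)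
    {u : ℝ → ℝ} (hu : ∀ x y, |u x - u y| ≤ |x - y|) (l : ℝ) :
    ∫⁻ x, ENNReal.ofReal (Real.exp (l * (u x - ∫ y, u y ∂ν))) ∂ν ≤
      ENNReal.ofReal (Real.exp (l ^ 2)) := by
  have hcont : Continuous u :=
    (LipschitzWith.of_dist_le_mul (K := 1) fun x y => by
      simpa [Real.dist_eq] using hu x y).continuous
  have huint : Integrable u ν := by
    refine ((integrable_const |u 0|).add hint.abs).mono' hcont.aestronglyMeasurable
      (Filter.Eventually.of_forall fun x => ?_)
    have := hu x 0
    rw [sub_zero] at this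
    rw [Real.norm_eq_abs]
    simp only [Pi.add_apply]
    linarith [abs_sub_abs_le_abs_sub (u x) (u 0)]
  set c := ∫ y, u y ∂ν with hc
  -- Jensen through `1 + y ≤ exp y`; taking the positive part of `1 + y` avoids any integrability
  -- claim about the exponential.
  have hone : 1 ≤ ∫⁻ x, ENNReal.ofReal (Real.exp (-(l * (u x - c)))) ∂ν := by
    have hi0 : Integrable (fun x => -(l * (u x - c))) ν :=
      ((huint.sub (integrable_const c)).const_mul l).neg
    have hi : Integrable (fun x => 1 + -(l * (u x - c))) ν := (integrable_const 1).add hi0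
    have : ∫ x, (1 + -(l * (u x - c))) ∂ν = 1 := by
      rw [integral_add (integrable_const 1) hi0,
        integral_neg, integral_const_mul, integral_sub huint (integrable_const c)]
      simp [hc]
    calc (1 : ℝ≥0∞) = ENNReal.ofReal (∫ x, (1 + -(l * (u x - c))) ∂ν) := by rw [this]; simp
      _ ≤ ENNReal.ofReal (∫ x, max (1 + -(l * (u x - c))) 0 ∂ν) :=
          ENNReal.ofReal_le_ofReal (integral_mono hi hi.pos_part fun x => le_max_left _ _)
      _ = ∫⁻ x, ENNReal.ofReal (max (1 + -(l * (u x - c))) 0) ∂ν :=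
          ofReal_integral_eq_lintegral_ofReal hi.pos_part
            (Filter.Eventually.of_forall fun x => le_max_right _ _)
      _ ≤ _ := lintegral_mono fun x => ENNReal.ofReal_le_ofReal (max_le
          (by linarith [Real.add_one_le_exp (-(l * (u x - c)))]) (Real.exp_nonneg _))
  have hg : ∀ s : ℝ, ∫⁻ x, ENNReal.ofReal (Real.exp (s * (x - m))) ∂ν ≤
      ENNReal.ofReal (Real.exp (s ^ 2 / 2)) := by
    intro s
    rw [← ofReal_integral_eq_lintegral_ofReal (hsub.integrable_exp_mul s)
      (Filter.Eventually.of_forall fun x => Real.exp_nonneg _)]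
    refine ENNReal.ofReal_le_ofReal ((hsub.mgf_le s).trans_eq ?_)
    simp
  calc ∫⁻ x, ENNReal.ofReal (Real.exp (l * (u x - c))) ∂ν
      ≤ (∫⁻ x, ENNReal.ofReal (Real.exp (l * (u x - c))) ∂ν) *
        ∫⁻ x, ENNReal.ofReal (Real.exp (-(l * (u x - c)))) ∂ν := le_mul_of_one_le_right zero_le hone
    _ ≤ (∫⁻ x, ENNReal.ofReal (Real.exp (l * (x - m))) ∂ν) *
        ∫⁻ x, ENNReal.ofReal (Real.exp (-(l * (x - m)))) ∂ν := by
        refine lintegral_exp_mul_lintegral_exp_neg_le ν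
          ((hcont.measurable.sub measurable_const).const_mul l) (by fun_prop) fun x y => ?_
        rw [← mul_sub, ← mul_sub, abs_mul, abs_mul, sub_sub_sub_cancel_right,
          sub_sub_sub_cancel_right]
        exact mul_le_mul_of_nonneg_left (hu x y) (abs_nonneg _)
    _ ≤ ENNReal.ofReal (Real.exp (l ^ 2 / 2)) * ENNReal.ofReal (Real.exp ((-l) ^ 2 / 2)) := by
        simp_rw [← neg_mul]
        exact mul_le_mul' (hg l) (hg (-l))
    _ = _ := by
        rw [← ENNReal.ofReal_mul (Real.exp_nonneg _), ← Real.exp_add]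
        congr 2; ring

theorem integrable_pi_of_lipschitz {ν : Measure ℝ} [IsProbabilityMeasure ν]
    (hint : Integrable (fun x : ℝ => x) ν) {n : ℕ} {g : (Fin n → ℝ) → ℝ}
    (hg : ∀ x y, |g x - g y| ≤ ∑ i, |x i - y i|) :
    Integrable g (Measure.pi fun _ => ν) ∧ Measurable g := by
  have hcont : Continuous g := by
    refine (LipschitzWith.of_dist_le_mul (K := (n : ℝ≥0)) fun x y => ?_).continuous
    rw [Real.dist_eq]
    calc |g x - g y| ≤ ∑ i, |x i - y i| := hg x y
      _ ≤ ∑ _i : Fin n, dist x y :=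
          Finset.sum_le_sum fun i _ => by rw [← Real.dist_eq]; exact dist_le_pi_dist x y i
      _ = _ := by simp
  have hi : ∀ i : Fin n, Integrable (fun x : Fin n → ℝ => x i) (Measure.pi fun _ => ν) :=
    fun i => integrable_comp_eval (μ := fun _ : Fin n => ν) (i := i) (f := fun x : ℝ => x) hint
  refine ⟨?_, hcont.measurable⟩
  refine ((integrable_const |g 0|).add (integrable_finsetSum Finset.univ fun i _ => (hi i).abs)).mono'
    hcont.aestronglyMeasurable (Filter.Eventually.of_forall fun x => ?_)
  have := hg x 0
  simp only [Pi.zero_apply, sub_zero] at this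
  rw [Real.norm_eq_abs]
  simp only [Pi.add_apply]
  linarith [abs_sub_abs_le_abs_sub (g x) (g 0)]

/-- Tensorization by induction: given the first coordinate, the deviation splits into that of the
remaining ones around their mean `G` and that of `G` around the total mean. Averaging keeps `G`
1-Lipschitz, so the one-dimensional bound covers the second part. -/
theorem lintegral_exp_lipschitz_pi_le {ν : Measure ℝ} [IsProbabilityMeasure ν]
    (hint : Integrable (fun x : ℝ => x) ν) {m : ℝ}
    (hsub : HasSubgaussianMGF (fun x : ℝ => x - m) 1 ν) (l : ℝ) :
    ∀ (n : ℕ) (g : (Fin n → ℝ) → ℝ), (∀ x y, |g x - g y| ≤ ∑ i, |x i - y i|) →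
      ∫⁻ x, ENNReal.ofReal (Real.exp (l * (g x - ∫ y, g y ∂(Measure.pi fun _ => ν))))
        ∂(Measure.pi fun _ => ν) ≤ ENNReal.ofReal (Real.exp (l ^ 2 * n))
  | 0, g, _ => by
    have : ∀ x, g x = ∫ y, g y ∂(Measure.pi fun _ => ν) := by
      intro x
      have h0 : g = fun _ => g x := funext fun y => by rw [Subsingleton.elim y x]
      rw [h0]; simp
    rw [← this 0]
    have h0 : ∀ x, g x - g 0 = 0 := fun x => by rw [Subsingleton.elim x 0, sub_self]
    simp_rw [h0]
    simp
  | n + 1, g, hg => by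
    have hmp := (measurePreserving_piFinSuccAbove (fun _ : Fin (n + 1) => ν) 0).symm
    set π := Measure.pi fun _ : Fin n => ν with hπ
    set e := (MeasurableEquiv.piFinSuccAbove (fun _ : Fin (n + 1) => ℝ) 0).symm with he
    have hee : ∀ p, e p = Fin.cons p.1 p.2 := by
      intro p
      ext j
      refine Fin.cases ?_ (fun j => ?_) j
      · rfl
      · rfl
    obtain ⟨gint, gmeas⟩ := integrable_pi_of_lipschitz hint hg
    set c := ∫ y, g y ∂(Measure.pi fun _ : Fin (n + 1) => ν) with hc
    have hcons : ∀ x0 y x0' y', |g (Fin.cons x0 y) - g (Fin.cons x0' y')| ≤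
        |x0 - x0'| + ∑ i, |y i - y' i| := by
      intro x0 y x0' y'
      refine (hg _ _).trans_eq ?_
      rw [Fin.sum_univ_succ]
      simp
    have hlip : ∀ x0 y y', |g (Fin.cons x0 y) - g (Fin.cons x0 y')| ≤ ∑ i, |y i - y' i| := by
      intro x0 y y'
      simpa using hcons x0 y x0 y'
    set G : ℝ → ℝ := fun x0 => ∫ y, g (Fin.cons x0 y) ∂π with hG
    have hGlip : ∀ x x', |G x - G x'| ≤ |x - x'| := by
      intro x x'
      simp only [hG]
      rw [← integral_sub (integrable_pi_of_lipschitz hint (hlip x)).1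
        (integrable_pi_of_lipschitz hint (hlip x')).1]
      have hb : ∀ y, ‖g (Fin.cons x y) - g (Fin.cons x' y)‖ ≤ |x - x'| := fun y => by
        rw [Real.norm_eq_abs]
        simpa using hcons x y x' y
      have := norm_integral_le_of_norm_le_const (μ := π) (Filter.Eventually.of_forall hb)
      rwa [probReal_univ, mul_one] at this
    have hcG : c = ∫ x, G x ∂ν := by
      have hi : Integrable (fun p => g (e p)) (ν.prod π) :=
        hmp.integrable_comp_of_integrable gint
      rw [hc, ← hmp.integral_comp' (g := g), integral_prod _ hi]
      simp_rw [hee, hG]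
    have hm2 : ∀ x0, Measurable fun y : Fin n → ℝ => g (Fin.cons x0 y) := fun x0 =>
      (integrable_pi_of_lipschitz hint (hlip x0)).2
    calc ∫⁻ x, ENNReal.ofReal (Real.exp (l * (g x - c))) ∂(Measure.pi fun _ : Fin (n + 1) => ν)
        = ∫⁻ p, ENNReal.ofReal (Real.exp (l * (g (e p) - c))) ∂(ν.prod π) :=
          (hmp.lintegral_comp (by fun_prop)).symm
      _ = ∫⁻ x0, ∫⁻ y, ENNReal.ofReal (Real.exp (l * (g (Fin.cons x0 y) - c))) ∂π ∂ν := by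
          rw [lintegral_prod _ (by have := e.measurable; fun_prop)]
          simp_rw [hee]
      _ = ∫⁻ x0, ENNReal.ofReal (Real.exp (l * (G x0 - c))) *
            ∫⁻ y, ENNReal.ofReal (Real.exp (l * (g (Fin.cons x0 y) - G x0))) ∂π ∂ν := by
          refine lintegral_congr fun x0 => ?_
          have := hm2 x0
          rw [← lintegral_const_mul _ (by fun_prop)]
          refine lintegral_congr fun y => ?_
          rw [← ENNReal.ofReal_mul (Real.exp_nonneg _), ← Real.exp_add]
          congr 2; ring
      _ ≤ ∫⁻ x0, ENNReal.ofReal (Real.exp (l * (G x0 - c))) *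
            ENNReal.ofReal (Real.exp (l ^ 2 * n)) ∂ν :=
          lintegral_mono fun x0 => mul_le_mul_right
            (lintegral_exp_lipschitz_pi_le hint hsub l n _ (hlip x0)) _
      _ = (∫⁻ x0, ENNReal.ofReal (Real.exp (l * (G x0 - c))) ∂ν) *
            ENNReal.ofReal (Real.exp (l ^ 2 * n)) := lintegral_mul_const' _ _ ENNReal.ofReal_ne_top
      _ ≤ ENNReal.ofReal (Real.exp (l ^ 2)) * ENNReal.ofReal (Real.exp (l ^ 2 * n)) := by
          rw [hcG]
          exact mul_le_mul_left (lintegral_exp_lipschitz_le hint hsub hGlip l) _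
      _ = _ := by
          rw [← ENNReal.ofReal_mul (Real.exp_nonneg _), ← Real.exp_add]
          congr 2; push_cast; ring

end Concentration

/-! ### Deviation of the empirical distribution of independent samples. -/

section EmpiricalDeviation

/-- The `L¹` norm of the difference of the counting function of a sample and its mean. -/
noncomputable def sampleDev (ν : Measure ℝ) {n : ℕ} (z : Fin n → ℝ) : ℝ≥0∞ :=
  ∫⁻ x, ENNReal.ofReal |∑ j, (stepAt (z j) x - cdf ν x)|

theorem measurable_sampleDev_integrand (ν : Measure ℝ) (n : ℕ) :
    Measurable fun p : (Fin n → ℝ) × ℝ =>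
      ENNReal.ofReal |∑ j, (stepAt (p.1 j) p.2 - cdf ν p.2)| := by
  refine (Finset.measurable_sum _ fun j _ => ?_).abs.ennreal_ofReal
  exact (((measurable_pi_apply j).comp measurable_fst).stepAt measurable_snd).sub
    ((measurable_cdf ν).comp measurable_snd)

theorem measurable_sampleDev (ν : Measure ℝ) (n : ℕ) :
    Measurable (sampleDev ν : (Fin n → ℝ) → ℝ≥0∞) :=
  (measurable_sampleDev_integrand ν n).lintegral_prod_right'

/-- Moving one sample point changes the counting function by a step difference whose `L¹` norm is
the distance moved. -/
theorem sampleDev_le_add (ν : Measure ℝ) {n : ℕ} (z z' : Fin n → ℝ) :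
    sampleDev ν z ≤ sampleDev ν z' + ENNReal.ofReal (∑ j, |z j - z' j|) := by
  have e : ENNReal.ofReal (∑ j, |z j - z' j|) =
      ∫⁻ x, ∑ j, ENNReal.ofReal |stepAt (z j) x - stepAt (z' j) x| := by
    rw [lintegral_finsetSum]
    · simp_rw [lintegral_abs_stepAt_sub, edist_dist, Real.dist_eq]
      rw [ENNReal.ofReal_sum_of_nonneg fun i _ => abs_nonneg _]
    · intro j _
      exact ((measurable_const.stepAt measurable_id).sub
        (measurable_const.stepAt measurable_id)).abs.ennreal_ofReal
  rw [e]
  unfold sampleDev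
  rw [← lintegral_add_left]
  · refine lintegral_mono fun x => ?_
    dsimp only
    rw [← ENNReal.ofReal_sum_of_nonneg fun i _ => abs_nonneg _,
      ← ENNReal.ofReal_add (abs_nonneg _) (Finset.sum_nonneg fun i _ => abs_nonneg _)]
    refine ENNReal.ofReal_le_ofReal ?_
    have : ∑ j, (stepAt (z j) x - cdf ν x) = ∑ j, (stepAt (z' j) x - cdf ν x) +
        ∑ j, (stepAt (z j) x - stepAt (z' j) x) := by
      rw [← Finset.sum_add_distrib]
      exact Finset.sum_congr rfl fun j _ => by ring
    rw [this]
    exact (abs_add_le _ _).trans (add_le_add_right (Finset.abs_sum_le_sum_abs _ _) _)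
  · exact (Finset.measurable_sum _ fun j _ =>
      (measurable_const.stepAt measurable_id).sub (measurable_cdf ν)).abs.ennreal_ofReal

/-- The sum consists of `n` independent centred Bernoulli variables of variance `p (1 - p)`, and a
first absolute moment is at most the standard deviation. -/
theorem lintegral_abs_sum_stepAt_le (ν : Measure ℝ) [IsProbabilityMeasure ν] (n : ℕ) (x : ℝ) :
    ∫⁻ z, ENNReal.ofReal |∑ j : Fin n, (stepAt (z j) x - cdf ν x)| ∂(Measure.pi fun _ => ν) ≤
      ENNReal.ofReal (√n * √(cdf ν x * (1 - cdf ν x))) := by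
  set p := cdf ν x with hp
  have hm : Measurable fun y : ℝ => stepAt y x - p :=
    (measurable_id.stepAt measurable_const).sub measurable_const
  have hbd : ∀ y : ℝ, ‖stepAt y x - p‖ ≤ 1 := fun y => by
    rw [Real.norm_eq_abs, abs_le]
    constructor <;> linarith [stepAt_nonneg y x, stepAt_le_one y x, cdf_nonneg ν x, cdf_le_one ν x]
  have hLp : MemLp (fun y : ℝ => stepAt y x - p) 2 ν :=
    MemLp.of_bound hm.aestronglyMeasurable 1 (Filter.Eventually.of_forall hbd)
  have hi1 : Integrable (fun y : ℝ => stepAt y x) ν := integrable_stepAt measurable_id x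
  have h0 : ∫ y, (stepAt y x - p) ∂ν = 0 := by
    rw [integral_sub hi1 (integrable_const p), integral_stepAt]; simp [hp]
  have hvar1 : Var[fun y : ℝ => stepAt y x - p; ν] = p * (1 - p) := by
    rw [variance_eq_sub hLp, h0]
    have : ∀ y, ((fun y : ℝ => stepAt y x - p) ^ 2) y = (1 - 2 * p) * stepAt y x + p ^ 2 := by
      intro y
      have : stepAt y x ^ 2 = stepAt y x := by unfold stepAt; split_ifs <;> norm_num
      simp only [Pi.pow_apply]
      linear_combination this
    simp_rw [this]
    rw [integral_add (hi1.const_mul _) (integrable_const _), integral_const_mul, integral_stepAt]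
    simp only [integral_const, probReal_univ, one_smul, ← hp]
    ring
  set π := Measure.pi fun _ : Fin n => ν with hπ
  set Z : (Fin n → ℝ) → ℝ := fun z => ∑ j : Fin n, (stepAt (z j) x - p) with hZ
  have hZm : Measurable Z :=
    Finset.measurable_sum _ fun j _ => hm.comp (measurable_pi_apply j)
  have hZsum : Z = ∑ j : Fin n, fun z : Fin n → ℝ => stepAt (z j) x - p := by
    ext z; simp [hZ]
  have hZbd : ∀ z, ‖Z z‖ ≤ n := fun z =>
    (norm_sum_le _ _).trans ((Finset.sum_le_sum fun j _ => hbd (z j)).trans_eq (by simp))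
  have hZLp : MemLp Z 2 π :=
    MemLp.of_bound hZm.aestronglyMeasurable n (Filter.Eventually.of_forall hZbd)
  have hZint : Integrable Z π := hZLp.integrable one_le_two
  have hZ0 : ∫ z, Z z ∂π = 0 := by
    simp only [hZ]
    rw [integral_finsetSum]
    · refine Finset.sum_eq_zero fun j _ => ?_
      rw [hπ, integral_comp_eval (μ := fun _ : Fin n => ν) (f := fun y : ℝ => stepAt y x - p)
        hm.aestronglyMeasurable, h0]
    · intro j _
      exact integrable_comp_eval (μ := fun _ : Fin n => ν) (f := fun y : ℝ => stepAt y x - p)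
        (hLp.integrable one_le_two)
  have hvar : Var[Z; π] = n * (p * (1 - p)) := by
    rw [hZsum, hπ, variance_sum_pi (X := fun (_ : Fin n) (y : ℝ) => stepAt y x - p) fun _ => hLp]
    simp [hvar1]
  have hsq : ∫ z, Z z ^ 2 ∂π = n * (p * (1 - p)) := by
    rw [← hvar, variance_eq_sub hZLp, hZ0]
    simp
  have habs : (∫ z, |Z z| ∂π) ^ 2 ≤ n * (p * (1 - p)) := by
    have hv := variance_nonneg (fun z => |Z z|) π
    rw [variance_eq_sub (show MemLp (fun z => |Z z|) 2 π from hZLp.abs)] at hv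
    have : ∫ z, ((fun z => |Z z|) ^ 2) z ∂π = ∫ z, Z z ^ 2 ∂π := by
      refine integral_congr_ae (Filter.Eventually.of_forall fun z => ?_)
      simp
    rw [this, hsq] at hv
    linarith
  rw [← ofReal_integral_eq_lintegral_ofReal hZint.abs
    (Filter.Eventually.of_forall fun z => abs_nonneg _), ← Real.sqrt_mul (Nat.cast_nonneg n)]
  exact ENNReal.ofReal_le_ofReal (Real.le_sqrt_of_sq_le habs)

/-- On either side of `m` the relevant tail is at most `exp (-(x - m) ^ 2 / 2)`. The root halves the
exponent, and the Gaussian integral is `√(4π) ≤ 4`. -/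
theorem lintegral_sqrt_cdf_le {ν : Measure ℝ} [IsProbabilityMeasure ν] {m : ℝ}
    (hsub : HasSubgaussianMGF (fun x : ℝ => x - m) 1 ν) :
    ∫⁻ x, ENNReal.ofReal √(cdf ν x * (1 - cdf ν x)) ≤ 4 := by
  have hpt : ∀ x, √(cdf ν x * (1 - cdf ν x)) ≤ Real.exp (-(1 / 4) * (x - m) ^ 2) := by
    intro x
    have h0 := cdf_nonneg ν x
    have h1 := cdf_le_one ν x
    have key : cdf ν x * (1 - cdf ν x) ≤ Real.exp (-(x - m) ^ 2 / 2) := by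
      rcases le_total m x with hmx | hmx
      · have := hsub.measure_ge_le (sub_nonneg.2 hmx)
        have h2 : 1 - cdf ν x ≤ ν.real {y | x - m ≤ y - m} := by
          rw [cdf_eq_real, ← probReal_compl_eq_one_sub measurableSet_Iic]
          refine measureReal_mono fun y hy => ?_
          simp only [compl_Iic, mem_Ioi] at hy
          simp only [mem_ofPred_eq]; linarith
        have h3 : cdf ν x * (1 - cdf ν x) ≤ 1 - cdf ν x := by nlinarith
        refine h3.trans (h2.trans (this.trans_eq ?_))
        simp
      · have := hsub.neg.measure_ge_le (sub_nonneg.2 hmx)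
        have h2 : cdf ν x ≤ ν.real {y | m - x ≤ (-fun y : ℝ => y - m) y} := by
          rw [cdf_eq_real]
          refine measureReal_mono fun y hy => ?_
          simp only [mem_Iic] at hy
          simp only [mem_ofPred_eq, Pi.neg_apply]; linarith
        have h3 : cdf ν x * (1 - cdf ν x) ≤ cdf ν x := by nlinarith
        refine h3.trans (h2.trans (this.trans_eq ?_))
        congr 1
        simp only [NNReal.coe_one]
        ring
    rw [Real.sqrt_le_left (Real.exp_nonneg _), ← Real.exp_nat_mul]
    refine key.trans_eq ?_
    congr 1; push_cast; ring
  have hint : Integrable fun x : ℝ => Real.exp (-(1 / 4) * (x - m) ^ 2) :=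
    (integrable_exp_neg_mul_sq (by norm_num : (0 : ℝ) < 1 / 4)).comp_sub_right m
  calc ∫⁻ x, ENNReal.ofReal √(cdf ν x * (1 - cdf ν x))
      ≤ ∫⁻ x, ENNReal.ofReal (Real.exp (-(1 / 4) * (x - m) ^ 2)) :=
        lintegral_mono fun x => ENNReal.ofReal_le_ofReal (hpt x)
    _ = ENNReal.ofReal (∫ x, Real.exp (-(1 / 4) * (x - m) ^ 2)) :=
        (ofReal_integral_eq_lintegral_ofReal hint
          (Filter.Eventually.of_forall fun x => Real.exp_nonneg _)).symm
    _ = ENNReal.ofReal √(Real.pi / (1 / 4)) := by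
        rw [integral_sub_right_eq_self (fun x : ℝ => Real.exp (-(1 / 4) * x ^ 2)) m,
          integral_gaussian]
    _ ≤ ENNReal.ofReal 4 := by
        refine ENNReal.ofReal_le_ofReal ?_
        rw [Real.sqrt_le_left (by norm_num)]
        linarith [Real.pi_lt_four]
    _ = 4 := by simp

theorem lintegral_sampleDev_le {ν : Measure ℝ} [IsProbabilityMeasure ν] {m : ℝ}
    (hsub : HasSubgaussianMGF (fun x : ℝ => x - m) 1 ν) (n : ℕ) :
    ∫⁻ z : Fin n → ℝ, sampleDev ν z ∂(Measure.pi fun _ => ν) ≤ ENNReal.ofReal (4 * √n) := by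
  unfold sampleDev
  rw [lintegral_lintegral_swap (measurable_sampleDev_integrand ν n).aemeasurable]
  calc ∫⁻ x, ∫⁻ z : Fin n → ℝ, ENNReal.ofReal |∑ j, (stepAt (z j) x - cdf ν x)|
          ∂(Measure.pi fun _ => ν)
      ≤ ∫⁻ x, ENNReal.ofReal √n * ENNReal.ofReal √(cdf ν x * (1 - cdf ν x)) :=
        lintegral_mono fun x => (lintegral_abs_sum_stepAt_le ν n x).trans_eq
          (ENNReal.ofReal_mul (Real.sqrt_nonneg _))
    _ = ENNReal.ofReal √n * ∫⁻ x, ENNReal.ofReal √(cdf ν x * (1 - cdf ν x)) :=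
        lintegral_const_mul' _ _ ENNReal.ofReal_ne_top
    _ ≤ ENNReal.ofReal √n * 4 := mul_le_mul_right (lintegral_sqrt_cdf_le hsub) _
    _ = _ := by
        rw [mul_comm, ENNReal.ofReal_mul (by norm_num)]; simp

theorem measure_sampleDev_gt_le {ν : Measure ℝ} [IsProbabilityMeasure ν]
    (hint : Integrable (fun x : ℝ => x) ν) {m : ℝ}
    (hsub : HasSubgaussianMGF (fun x : ℝ => x - m) 1 ν) {n T : ℕ} (hn : 0 < n) (hT : 1 ≤ T) :
    (Measure.pi fun _ : Fin n => ν) {z | ENNReal.ofReal (n * confRadius T n) < sampleDev ν z} ≤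
      ENNReal.ofReal (Real.exp (-4 * Real.log T)) := by
  set π := Measure.pi fun _ : Fin n => ν with hπ
  have hmean := lintegral_sampleDev_le hsub n
  have hae : ∀ᵐ z ∂π, sampleDev ν z < ⊤ :=
    ae_lt_top (measurable_sampleDev ν n) (hmean.trans_lt ENNReal.ofReal_lt_top).ne
  obtain ⟨z₀, hz₀⟩ := hae.exists
  -- Finiteness at one sample spreads to all samples by the Lipschitz bound.
  have hfin : ∀ z : Fin n → ℝ, sampleDev ν z ≠ ⊤ := fun z =>
    ((sampleDev_le_add ν z z₀).trans_lt
      (ENNReal.add_lt_top.2 ⟨hz₀, ENNReal.ofReal_lt_top⟩)).ne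
  set g : (Fin n → ℝ) → ℝ := fun z => (sampleDev ν z).toReal with hg
  have hlip1 : ∀ x y, g x - g y ≤ ∑ i, |x i - y i| := by
    intro x y
    have h := ENNReal.toReal_mono (ENNReal.add_ne_top.2 ⟨hfin y, ENNReal.ofReal_ne_top⟩)
      (sampleDev_le_add ν x y)
    rw [ENNReal.toReal_add (hfin y) ENNReal.ofReal_ne_top,
      ENNReal.toReal_ofReal (Finset.sum_nonneg fun i _ => abs_nonneg _)] at h
    simp only [hg]; linarith
  have hlip : ∀ x y, |g x - g y| ≤ ∑ i, |x i - y i| := by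
    intro x y
    refine abs_sub_le_iff.2 ⟨hlip1 x y, ?_⟩
    simpa only [abs_sub_comm] using hlip1 y x
  have hgm : Measurable g := (measurable_sampleDev ν n).ennreal_toReal
  have hEg : ∫ z, g z ∂π ≤ 4 * √n := by
    simp only [hg]
    rw [integral_toReal (measurable_sampleDev ν n).aemeasurable hae]
    exact ENNReal.toReal_le_of_le_ofReal (by positivity) hmean
  set c := ∫ z, g z ∂π with hc
  have hn' : (0 : ℝ) < n := Nat.cast_pos.2 hn
  have hsn : 0 < √(n : ℝ) := Real.sqrt_pos.2 hn'
  have hlog : 0 ≤ Real.log T := Real.log_nonneg (by exact_mod_cast hT)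
  set r := √(Real.log T) with hr
  have hr2 : r ^ 2 = Real.log T := Real.sq_sqrt hlog
  have hr0 : 0 ≤ r := Real.sqrt_nonneg _
  have hsn2 : √(n : ℝ) ^ 2 = n := Real.sq_sqrt hn'.le
  have hrad : n * confRadius T n = 16 * (√(2 * Real.exp 1 * Real.log T) + 32) * √n := by
    unfold confRadius
    field_simp
    rw [hsn2]
  have hsqrt : r ≤ √(2 * Real.exp 1 * Real.log T) := by
    refine Real.sqrt_le_sqrt ?_
    have := Real.add_one_le_exp 1
    nlinarith
  -- With this Chernoff parameter the moment bound is `exp (4 log T)`. The threshold exceeds the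
  -- mean, at most `4√n`, by at least `16 r √n`, which contributes `exp (32 log T)`; the quotient is
  -- far below the required `exp (-4 log T)`.
  set l := 2 * r / √n with hl
  have hl0 : 0 ≤ l := by positivity
  have hsub' : {z | ENNReal.ofReal (n * confRadius T n) < sampleDev ν z} ⊆
      {z | ENNReal.ofReal (Real.exp (32 * Real.log T)) ≤
        ENNReal.ofReal (Real.exp (l * (g z - c)))} := by
    intro z hz
    simp only [mem_ofPred_eq] at hz ⊢
    refine ENNReal.ofReal_le_ofReal (Real.exp_le_exp.2 ?_)
    have h1 : n * confRadius T n < g z := (ENNReal.ofReal_lt_iff_lt_toReal (by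
      rw [hrad]; positivity) (hfin z)).1 hz
    have h2 : 16 * r * √n ≤ g z - c := by
      rw [hrad] at h1
      nlinarith
    calc 32 * Real.log T = l * (16 * r * √n) := by
          rw [hl, ← hr2]; field_simp; ring
      _ ≤ _ := mul_le_mul_of_nonneg_left h2 hl0
  have hmain := lintegral_exp_lipschitz_pi_le hint hsub l n g hlip
  have hmarkov := mul_meas_ge_le_lintegral (μ := π)
    (f := fun z => ENNReal.ofReal (Real.exp (l * (g z - c)))) (by fun_prop)
    (ENNReal.ofReal (Real.exp (32 * Real.log T)))
  have hln : l ^ 2 * n = 4 * Real.log T := by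
    rw [hl, ← hr2, div_pow, hsn2]; field_simp; ring
  rw [hln] at hmain
  have h3 := (mul_le_mul_right (measure_mono (μ := π) hsub') _).trans (hmarkov.trans hmain)
  have h4 : π {z | ENNReal.ofReal (n * confRadius T n) < sampleDev ν z} =
      ENNReal.ofReal (Real.exp (-(32 * Real.log T))) * (ENNReal.ofReal (Real.exp (32 * Real.log T)) *
        π {z | ENNReal.ofReal (n * confRadius T n) < sampleDev ν z}) := by
    rw [← mul_assoc, ← ENNReal.ofReal_mul (Real.exp_nonneg _), ← Real.exp_add]
    simp
  rw [h4]
  refine (mul_le_mul_right h3 _).trans ?_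
  rw [← ENNReal.ofReal_mul (Real.exp_nonneg _), ← Real.exp_add]
  exact ENNReal.ofReal_le_ofReal (Real.exp_le_exp.2 (by linarith))

end EmpiricalDeviation

/-! ### From adaptively collected rewards to independent samples. -/

section OptionalSkipping

variable {K : ℕ} {Ω : Type*}

theorem pullCount_succ (A : ℕ → Ω → Fin K) (t : ℕ) (i : Fin K) (ω : Ω) :
    pullCount A (t + 1) i ω = pullCount A t i ω + if A t ω = i then 1 else 0 := by
  unfold pullCount
  rw [Finset.range_add_one, Finset.filter_insert]
  split_ifs with h
  · rw [Finset.card_insert_of_notMem (by simp)]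
  · simp

theorem pullCount_zero (A : ℕ → Ω → Fin K) (i : Fin K) (ω : Ω) : pullCount A 0 i ω = 0 := by
  simp [pullCount]

theorem pullCount_mono (A : ℕ → Ω → Fin K) (i : Fin K) (ω : Ω) :
    Monotone fun t => pullCount A t i ω :=
  monotone_nat_of_le_succ fun t => by rw [pullCount_succ]; omega

theorem pullCount_le (A : ℕ → Ω → Fin K) (t : ℕ) (i : Fin K) (ω : Ω) : pullCount A t i ω ≤ t :=
  (Finset.card_filter_le _ _).trans_eq (Finset.card_range t)

theorem sum_pullCount (A : ℕ → Ω → Fin K) (t : ℕ) (ω : Ω) : ∑ i, pullCount A t i ω = t := by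
  induction t with
  | zero => simp [pullCount_zero]
  | succ t ih => simp_rw [pullCount_succ, Finset.sum_add_distrib, ih]; simp

/-- The record of the first `n` rewards of arm `i`, as known after `t` rounds (with `0` in the
places that are not filled yet). -/
noncomputable def rewardRecord (A : ℕ → Ω → Fin K) (X : ℕ → Ω → ℝ) (i : Fin K) (n : ℕ) : ℕ → Ω → Fin n → ℝ
  | 0, _, _ => 0
  | t + 1, ω, j => if A t ω = i ∧ (j : ℕ) = pullCount A t i ω then X t ω
      else rewardRecord A X i n t ω j

theorem sum_rewardRecord (A : ℕ → Ω → Fin K) (X : ℕ → Ω → ℝ) (i : Fin K) (n : ℕ) (ω : Ω)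
    (φ : ℝ → ℝ) (t : ℕ) (ht : pullCount A t i ω ≤ n) :
    ∑ s ∈ (Finset.range t).filter (fun s => A s ω = i), φ (X s ω) =
      ∑ j : Fin n, if (j : ℕ) < pullCount A t i ω then φ (rewardRecord A X i n t ω j) else 0 := by
  induction t with
  | zero => simp [pullCount_zero]
  | succ t ih =>
    rw [pullCount_succ] at ht ⊢
    rw [Finset.range_add_one, Finset.filter_insert]
    by_cases h : A t ω = i
    · simp only [h, if_true] at ht ⊢
      rw [Finset.sum_insert (by simp), ih (by omega)]
      set k := pullCount A t i ω with hk
      have e : φ (X t ω) = ∑ j : Fin n, if j = ⟨k, by omega⟩ then φ (X t ω) else 0 := by simp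
      rw [e, ← Finset.sum_add_distrib]
      refine Finset.sum_congr rfl fun j _ => ?_
      simp only [rewardRecord, h, true_and, ← hk, Fin.ext_iff]
      rcases lt_trichotomy (j : ℕ) k with hj | hj | hj
      · simp [hj, hj.ne, hj.trans (Nat.lt_succ_self k)]
      · simp [hj]
      · simp [hj.ne', not_lt.2 hj.le, not_lt.2 (Nat.succ_le_of_lt hj)]
    · simp only [h, if_false, add_zero] at ht ⊢
      rw [ih ht]
      simp [rewardRecord, h]

variable {mΩ : MeasurableSpace Ω} {P : Measure Ω} {F : Fin K → Measure ℝ} {T : ℕ}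
  {ℱ : Filtration ℕ mΩ} {A : ℕ → Ω → Fin K} {X : ℕ → Ω → ℝ}

theorem IsBanditRun.measurable_pullCount (hrun : IsBanditRun P F T ℱ A X) (i : Fin K) :
    ∀ t ≤ T, Measurable[ℱ t] (pullCount A t i)
  | 0, _ => by
    have : pullCount A 0 i = fun _ => 0 := funext fun ω => pullCount_zero A i ω
    rw [this]; exact measurable_const
  | t + 1, ht => by
    have h1 : Measurable[ℱ (t + 1)] (pullCount A t i) :=
      (hrun.measurable_pullCount i t (by omega)).mono (ℱ.mono (Nat.le_succ t)) le_rfl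
    have h2 : Measurable[ℱ (t + 1)] (A t) :=
      (hrun.action_meas t (by omega)).mono (ℱ.mono (Nat.le_succ t)) le_rfl
    have : pullCount A (t + 1) i = fun ω => pullCount A t i ω + if A t ω = i then 1 else 0 :=
      funext fun ω => pullCount_succ A t i ω
    rw [this]
    exact Measurable.add (m := ℱ (t + 1)) h1 (Measurable.ite (h2 (measurableSet_singleton i))
      measurable_const measurable_const)

theorem IsBanditRun.measurable_rewardRecord (hrun : IsBanditRun P F T ℱ A X) (i : Fin K) (n : ℕ) :
    ∀ t ≤ T, Measurable[ℱ t] (rewardRecord A X i n t)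
  | 0, _ => measurable_const
  | t + 1, ht => by
    have h1 : Measurable[ℱ (t + 1)] (pullCount A t i) :=
      (hrun.measurable_pullCount i t (by omega)).mono (ℱ.mono (Nat.le_succ t)) le_rfl
    have h2 : Measurable[ℱ (t + 1)] (A t) :=
      (hrun.action_meas t (by omega)).mono (ℱ.mono (Nat.le_succ t)) le_rfl
    have h3 : Measurable[ℱ (t + 1)] (rewardRecord A X i n t) :=
      (hrun.measurable_rewardRecord i n t (by omega)).mono (ℱ.mono (Nat.le_succ t)) le_rfl
    refine @measurable_pi_lambda _ _ _ (ℱ (t + 1)) _ _ fun j => ?_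
    refine Measurable.ite ?_ (hrun.reward_meas t (by omega))
      ((measurable_pi_apply j).comp h3)
    exact MeasurableSet.inter (h2 (measurableSet_singleton i))
      (h1 (MeasurableSet.of_discrete (s := {k : ℕ | (j : ℕ) = k})))

theorem IsBanditRun.measure_inter_eq [IsProbabilityMeasure P] [∀ i, IsProbabilityMeasure (F i)]
    (hrun : IsBanditRun P F T ℱ A X) {t : ℕ} (ht : t < T) (i : Fin K) {D : Set Ω}
    (hD : MeasurableSet[ℱ t] D) (hDi : ∀ ω ∈ D, A t ω = i) {E : Set ℝ} (hE : MeasurableSet E) :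
    P (D ∩ X t ⁻¹' E) = P D * F i E := by
  have hX : Measurable (X t) := (hrun.reward_meas t ht).mono (ℱ.le _) le_rfl
  have hDm : MeasurableSet D := ℱ.le t D hD
  have hi : Integrable ((X t ⁻¹' E).indicator fun _ => (1 : ℝ)) P :=
    (integrable_const 1).indicator (hX hE)
  have h1 := setIntegral_condExp (ℱ.le t) hi hD
  have h2 : ∫ ω in D, (P[(X t ⁻¹' E).indicator (fun _ => (1 : ℝ)) | ℱ t]) ω ∂P =
      ∫ _ω in D, (F i).real E ∂P := by
    refine setIntegral_congr_ae hDm ?_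
    filter_upwards [hrun.reward_law t ht E hE] with ω hω hωD
    rw [hω, hDi ω hωD]
  rw [h2, setIntegral_const, integral_indicator (hX hE), Measure.restrict_restrict (hX hE),
    setIntegral_const, inter_comm] at h1
  simp only [smul_eq_mul, mul_one] at h1
  rw [← ENNReal.toReal_eq_toReal_iff' (measure_ne_top _ _)
    (ENNReal.mul_ne_top (measure_ne_top _ _) (measure_ne_top _ _)), ENNReal.toReal_mul]
  exact h1.symm

/-- The reward is a fresh draw given the past: on the event that arm `i` is chosen, the joint law of
`H` and the reward is a product, as a check on rectangles shows. -/
theorem IsBanditRun.lintegral_reward_eq [IsProbabilityMeasure P]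
    [∀ i, IsProbabilityMeasure (F i)] (hrun : IsBanditRun P F T ℱ A X) {t : ℕ} (ht : t < T)
    (i : Fin K) {β : Type*} [MeasurableSpace β] {H : Ω → β} (hH : Measurable[ℱ t] H)
    {Φ : β × ℝ → ℝ≥0∞} (hΦ : Measurable Φ) :
    ∫⁻ ω in {ω | A t ω = i}, Φ (H ω, X t ω) ∂P =
      ∫⁻ ω in {ω | A t ω = i}, ∫⁻ x, Φ (H ω, x) ∂(F i) ∂P := by
  have hX : Measurable (X t) := (hrun.reward_meas t ht).mono (ℱ.le _) le_rfl
  have hHm : Measurable H := hH.mono (ℱ.le t) le_rfl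
  have hA : MeasurableSet[ℱ t] {ω | A t ω = i} :=
    hrun.action_meas t ht (measurableSet_singleton i)
  have hprod : ((P.restrict {ω | A t ω = i}).map H).prod (F i) =
      (P.restrict {ω | A t ω = i}).map fun ω => (H ω, X t ω) := by
    refine Measure.prod_eq fun C E hC hE => ?_
    rw [Measure.map_apply (hHm.prodMk hX) (hC.prod hE), Measure.map_apply hHm hC,
      Measure.restrict_apply (hHm hC), Measure.restrict_apply ((hHm.prodMk hX) (hC.prod hE)),
      ← hrun.measure_inter_eq ht i (MeasurableSet.inter (hH hC) hA) (fun ω hω => hω.2) hE]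
    congr 1
    ext ω
    simp only [mem_inter_iff, mem_preimage, mem_prod]
    tauto
  calc ∫⁻ ω in {ω | A t ω = i}, Φ (H ω, X t ω) ∂P
      = ∫⁻ p, Φ p ∂((P.restrict {ω | A t ω = i}).map fun ω => (H ω, X t ω)) :=
        (lintegral_map hΦ (hHm.prodMk hX)).symm
    _ = ∫⁻ b, ∫⁻ x, Φ (b, x) ∂(F i) ∂((P.restrict {ω | A t ω = i}).map H) := by
        rw [← hprod, lintegral_prod _ hΦ.aemeasurable]
    _ = _ := lintegral_map hΦ.lintegral_prod_right' hHm

/-- The conditional mean of `g`, given the first `k` of `n` independent samples. -/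
noncomputable def tailMean (ν : Measure ℝ) {n : ℕ} (g : (Fin n → ℝ) → ℝ≥0∞) (p : ℕ × (Fin n → ℝ)) : ℝ≥0∞ :=
  lmarginal (fun _ => ν) (Finset.univ.filter fun j : Fin n => p.1 ≤ j) g p.2

theorem measurable_tailMean (ν : Measure ℝ) [SigmaFinite ν] {n : ℕ} {g : (Fin n → ℝ) → ℝ≥0∞}
    (hg : Measurable g) : Measurable (tailMean ν g) :=
  measurable_from_prod_countable_right fun k => hg.lmarginal
    (s := Finset.univ.filter fun j : Fin n => k ≤ j) fun _ => ν

/-- The one-step martingale property: a fresh draw in slot `k` integrates out that coordinate. For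
`k ≥ n` there is no such slot and nothing changes. -/
theorem lintegral_tailMean_succ (ν : Measure ℝ) [IsProbabilityMeasure ν] {n : ℕ}
    {g : (Fin n → ℝ) → ℝ≥0∞} (hg : Measurable g) (k : ℕ) (z : Fin n → ℝ) :
    ∫⁻ x, tailMean ν g (k + 1, fun j => if (j : ℕ) = k then x else z j) ∂ν =
      tailMean ν g (k, z) := by
  unfold tailMean
  by_cases hk : k < n
  · have e1 : (Finset.univ.filter fun j : Fin n => k ≤ j) =
        insert ⟨k, hk⟩ (Finset.univ.filter fun j : Fin n => k + 1 ≤ j) := by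
      ext j
      simp only [Finset.mem_filter, Finset.mem_univ, true_and, Finset.mem_insert, Fin.ext_iff]
      omega
    have e2 : ∀ x, (fun j : Fin n => if (j : ℕ) = k then x else z j) =
        Function.update z ⟨k, hk⟩ x := by
      intro x
      ext j
      simp [Function.update_apply, Fin.ext_iff]
    simp only [e1, e2]
    rw [lmarginal_insert g hg (by simp)]
  · have e1 : (Finset.univ.filter fun j : Fin n => k ≤ j) = ∅ := by
      ext j; simp; omega
    have e2 : (Finset.univ.filter fun j : Fin n => k + 1 ≤ j) = ∅ := by
      ext j; simp; omega
    have e3 : ∀ x, (fun j : Fin n => if (j : ℕ) = k then x else z j) = z := by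
      intro x; ext j
      rw [if_neg (by omega)]
    simp only [e1, e2, e3]
    simp

/-- Along the run `tailMean` has constant expectation: a pull of arm `i` fills the next slot with a
fresh draw, and any other pull leaves the record alone. At time `0` all slots are still averaged,
which gives the product integral. -/
theorem IsBanditRun.lintegral_tailMean_eq [IsProbabilityMeasure P]
    [∀ i, IsProbabilityMeasure (F i)] (hrun : IsBanditRun P F T ℱ A X) (i : Fin K) {n : ℕ}
    {g : (Fin n → ℝ) → ℝ≥0∞} (hg : Measurable g) (t : ℕ) (ht : t ≤ T) :
    ∫⁻ ω, tailMean (F i) g (pullCount A t i ω, rewardRecord A X i n t ω) ∂P =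
      ∫⁻ z, g z ∂(Measure.pi fun _ => F i) := by
  induction t with
  | zero => simp [pullCount_zero, rewardRecord, tailMean]
  | succ t ih =>
    rw [← ih (by omega)]
    have hA : MeasurableSet {ω | A t ω = i} :=
      ℱ.le t _ (hrun.action_meas t (by omega) (measurableSet_singleton i))
    rw [← lintegral_add_compl _ hA, ← lintegral_add_compl (fun ω => tailMean (F i) g
      (pullCount A t i ω, rewardRecord A X i n t ω)) hA]
    congr 1
    · have hH : Measurable[ℱ t] fun ω => (pullCount A t i ω, rewardRecord A X i n t ω) :=
        Measurable.prodMk (hrun.measurable_pullCount i t (by omega))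
          (hrun.measurable_rewardRecord i n t (by omega))
      have hΦ : Measurable fun p : (ℕ × (Fin n → ℝ)) × ℝ =>
          tailMean (F i) g (p.1.1 + 1, fun j => if (j : ℕ) = p.1.1 then p.2 else p.1.2 j) := by
        refine (measurable_tailMean (F i) hg).comp (Measurable.prodMk ?_ ?_)
        · exact (measurable_of_countable fun k : ℕ => k + 1).comp
            (measurable_fst.comp measurable_fst)
        · refine measurable_pi_lambda _ fun j => ?_
          refine Measurable.ite ?_ measurable_snd
            ((measurable_pi_apply j).comp (measurable_snd.comp measurable_fst))
          exact (measurable_fst.comp measurable_fst)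
            (MeasurableSet.of_discrete (s := {k : ℕ | (j : ℕ) = k}))
      have key := hrun.lintegral_reward_eq (by omega : t < T) i hH hΦ
      simp only [lintegral_tailMean_succ (F i) hg] at key
      rw [← key]
      refine setLIntegral_congr_fun hA fun ω hω => ?_
      have hω' : A t ω = i := hω
      simp only [pullCount_succ, hω', if_true]
      congr 2
      ext j
      simp [rewardRecord, hω']
    · refine setLIntegral_congr_fun hA.compl fun ω hω => ?_
      have hω' : ¬ A t ω = i := hω
      simp only [pullCount_succ, hω', if_false, add_zero]
      congr 2
      ext j
      simp [rewardRecord, hω']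

/-- The first `n` rewards of an arm are dominated by `n` independent samples. -/
theorem IsBanditRun.measure_rewardRecord_le [IsProbabilityMeasure P]
    [∀ i, IsProbabilityMeasure (F i)] (hrun : IsBanditRun P F T ℱ A X) (i : Fin K) {n : ℕ}
    {B : Set (Fin n → ℝ)} (hB : MeasurableSet B) {t : ℕ} (ht : t ≤ T) :
    P {ω | pullCount A t i ω = n ∧ rewardRecord A X i n t ω ∈ B} ≤
      (Measure.pi fun _ => F i) B := by
  have hm1 : Measurable (pullCount A t i) :=
    (hrun.measurable_pullCount i t ht).mono (ℱ.le t) le_rfl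
  have hm2 : Measurable (rewardRecord A X i n t) :=
    (hrun.measurable_rewardRecord i n t ht).mono (ℱ.le t) le_rfl
  have hm : MeasurableSet {ω | pullCount A t i ω = n ∧ rewardRecord A X i n t ω ∈ B} :=
    (hm1 (measurableSet_singleton n)).inter (hm2 hB)
  rw [← lintegral_indicator_one hB, ← hrun.lintegral_tailMean_eq i
    (measurable_one.indicator hB) t ht, ← lintegral_indicator_one hm]
  refine lintegral_mono fun ω => ?_
  -- Once all `n` slots are filled nothing is left to average and `tailMean` is the indicator of `B`
  -- itself; in all other cases nonnegativity suffices.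
  by_cases hω : pullCount A t i ω = n ∧ rewardRecord A X i n t ω ∈ B
  · have e : (Finset.univ.filter fun j : Fin n => n ≤ j) = ∅ := by
      ext j; simp
    simp [tailMean, e, hω.2, hω.1]
  · simp [indicator, hω]

theorem cdf_empiricalDist (i : Fin K) {n t : ℕ} {ω : Ω} (hn : 0 < n)
    (h : pullCount A t i ω = n) :
    IsProbabilityMeasure (empiricalDist A X t i ω) ∧ ∀ x, cdf (empiricalDist A X t i ω) x =
      (n : ℝ)⁻¹ * ∑ j, stepAt (rewardRecord A X i n t ω j) x := by
  have hprob : IsProbabilityMeasure (empiricalDist A X t i ω) := by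
    refine ⟨?_⟩
    have hc : ((Finset.range t).filter fun s => A s ω = i).card = n := h
    simp only [empiricalDist, Measure.smul_apply, Measure.finsetSum_apply, measure_univ,
      Finset.sum_const, nsmul_eq_mul, mul_one, smul_eq_mul, h, hc]
    exact ENNReal.inv_mul_cancel (by exact_mod_cast hn.ne') (ENNReal.natCast_ne_top n)
  refine ⟨hprob, fun x => ?_⟩
  have hs := sum_rewardRecord A X i n ω (fun y => stepAt y x) t h.le
  simp only [h, Fin.is_lt, if_true] at hs
  rw [← hs, cdf_eq_real, measureReal_def]
  simp only [empiricalDist, Measure.smul_apply, Measure.finsetSum_apply, smul_eq_mul, h]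
  rw [ENNReal.toReal_mul, ENNReal.toReal_inv, ENNReal.toReal_natCast,
    ENNReal.toReal_sum fun s _ => measure_ne_top _ _]
  congr 1
  refine Finset.sum_congr rfl fun s _ => ?_
  rw [Measure.dirac_apply' _ measurableSet_Iic]
  by_cases hx : X s ω ≤ x <;> simp [stepAt, hx]

theorem cdfDist_empiricalDist (i : Fin K) (ν : Measure ℝ) {n t : ℕ} {ω : Ω} (hn : 0 < n)
    (h : pullCount A t i ω = n) :
    cdfDist (empiricalDist A X t i ω) ν =
      ENNReal.ofReal (n : ℝ)⁻¹ * sampleDev ν (rewardRecord A X i n t ω) := by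
  unfold cdfDist sampleDev
  rw [← lintegral_const_mul' _ _ ENNReal.ofReal_ne_top]
  refine lintegral_congr fun x => ?_
  have hn' : (0 : ℝ) < n := Nat.cast_pos.2 hn
  rw [(cdf_empiricalDist i hn h).2 x, ← ENNReal.ofReal_mul (by positivity)]
  congr 1
  rw [← abs_of_pos (inv_pos.2 hn'), ← abs_mul, abs_of_pos (inv_pos.2 hn'), Finset.sum_sub_distrib]
  congr 1
  simp only [Finset.sum_const, Finset.card_univ, Fintype.card_fin, nsmul_eq_mul]
  field_simp

/-- The event that some empirical distribution leaves its confidence region. -/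
noncomputable def badEvent (F : Fin K → Measure ℝ) (T : ℕ) (A : ℕ → Ω → Fin K) (X : ℕ → Ω → ℝ) : Set Ω :=
  ⋃ i : Fin K, ⋃ t ∈ Finset.range T, ⋃ n ∈ Finset.Ioo 0 T,
    {ω | pullCount A t i ω = n ∧
      rewardRecord A X i n t ω ∈ {z | ENNReal.ofReal (n * confRadius T n) < sampleDev (F i) z}}

theorem cdfDist_le_of_notMem_badEvent {ω : Ω} (hω : ω ∉ badEvent F T A X) (i : Fin K) {t : ℕ}
    (ht : t < T) (h0 : 0 < pullCount A t i ω) :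
    cdfDist (empiricalDist A X t i ω) (F i) ≤
      ENNReal.ofReal (confRadius T (pullCount A t i ω)) := by
  have hn : pullCount A t i ω ∈ Finset.Ioo 0 T :=
    Finset.mem_Ioo.2 ⟨h0, (pullCount_le A t i ω).trans_lt ht⟩
  simp only [badEvent, mem_iUnion, not_exists] at hω
  have := hω i t (Finset.mem_range.2 ht) _ hn
  simp only [mem_ofPred_eq, true_and, not_lt] at this
  rw [cdfDist_empiricalDist i (F i) h0 rfl]
  refine (mul_le_mul_right this _).trans_eq ?_
  have hn' : (0 : ℝ) < pullCount A t i ω := Nat.cast_pos.2 h0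
  rw [← ENNReal.ofReal_mul (by positivity), inv_mul_cancel_left₀ hn'.ne']

theorem IsBanditRun.measurableSet_badEvent (hrun : IsBanditRun P F T ℱ A X) :
    MeasurableSet (badEvent F T A X) := by
  refine MeasurableSet.iUnion fun i => Finset.measurableSet_biUnion _ fun t ht =>
    Finset.measurableSet_biUnion _ fun n _ => ?_
  have ht' := (Finset.mem_range.1 ht).le
  have hm1 : Measurable (pullCount A t i) :=
    (hrun.measurable_pullCount i t ht').mono (ℱ.le t) le_rfl
  have hm2 : Measurable (rewardRecord A X i n t) :=
    (hrun.measurable_rewardRecord i n t ht').mono (ℱ.le t) le_rfl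
  exact (hm1 (measurableSet_singleton n)).inter
    (hm2 (measurableSet_lt measurable_const (measurable_sampleDev (F i) n)))

/-- A union bound over at most `K T ^ 2` triples of arm, time and sample size, each of probability
at most `T ^ (-4)`. The sum over sample sizes is needed because the count is random. -/
theorem IsBanditRun.measure_badEvent_le [IsProbabilityMeasure P] {S : Set ℝ}
    (hF : ∀ i, F i ∈ FiniteMean S)
    (hsub : ∀ i, HasSubgaussianMGF (fun x : ℝ => x - ∫ y, y ∂(F i)) 1 (F i))
    (hrun : IsBanditRun P F T ℱ A X) (hT : 1 ≤ T) :
    P.real (badEvent F T A X) ≤ K / T ^ 2 := by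
  have hprob : ∀ i, IsProbabilityMeasure (F i) := fun i => (hF i).1
  have hT' : (0 : ℝ) < T := by exact_mod_cast hT
  have hexp : Real.exp (-4 * Real.log T) = ((T : ℝ) ^ 4)⁻¹ := by
    rw [neg_mul, Real.exp_neg, ← Real.exp_log hT', ← Real.exp_nat_mul, Real.log_exp]
    push_cast; rfl
  have h1 : P (badEvent F T A X) ≤ ∑ _i : Fin K, ∑ _t ∈ Finset.range T, ∑ _n ∈ Finset.Ioo 0 T,
      ENNReal.ofReal ((T : ℝ) ^ 4)⁻¹ := by
    refine (measure_iUnion_fintype_le _ _).trans (Finset.sum_le_sum fun i _ => ?_)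
    refine (measure_biUnion_finset_le _ _).trans (Finset.sum_le_sum fun t ht => ?_)
    refine (measure_biUnion_finset_le _ _).trans (Finset.sum_le_sum fun n hn => ?_)
    refine (hrun.measure_rewardRecord_le i
      (measurableSet_lt measurable_const (measurable_sampleDev (F i) n))
      (Finset.mem_range.1 ht).le).trans ?_
    rw [← hexp]
    exact measure_sampleDev_gt_le (hF i).2.2 (hsub i) (Finset.mem_Ioo.1 hn).1 hT
  have h2 : ∑ _i : Fin K, ∑ _t ∈ Finset.range T, ∑ _n ∈ Finset.Ioo 0 T,
      ENNReal.ofReal ((T : ℝ) ^ 4)⁻¹ ≤ ENNReal.ofReal (K / T ^ 2) := by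
    simp only [Finset.sum_const, Finset.card_univ, Fintype.card_fin, Finset.card_range,
      Nat.card_Ioo, nsmul_eq_mul]
    have hle : ((T - 0 - 1 : ℕ) : ℝ≥0∞) ≤ (T : ℝ≥0∞) := by
      exact_mod_cast (by omega : T - 0 - 1 ≤ T)
    refine (mul_le_mul_right (mul_le_mul_right (mul_le_mul_left hle _) _) _).trans_eq ?_
    rw [← ENNReal.ofReal_natCast T, ← ENNReal.ofReal_natCast K,
      ← ENNReal.ofReal_mul hT'.le, ← ENNReal.ofReal_mul hT'.le,
      ← ENNReal.ofReal_mul (Nat.cast_nonneg _)]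
    congr 1
    field_simp
  exact ENNReal.toReal_le_of_le_ofReal (by positivity) (h1.trans h2)

end OptionalSkipping

/-! ### Optimistic indices and identification of the best discretized mixture. -/

section Optimism

variable {K : ℕ}

theorem Real.rpow_sum_le_sum_rpow {ι : Type*} (s : Finset ι) {f : ι → ℝ} (hf : ∀ i, 0 ≤ f i)
    {q : ℝ} (hq : q ∈ Ioc (0 : ℝ) 1) : (∑ i ∈ s, f i) ^ q ≤ ∑ i ∈ s, f i ^ q := by
  classical
  induction s using Finset.induction_on with
  | empty => simp [Real.zero_rpow hq.1.ne']
  | insert i s hi ih =>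
    rw [Finset.sum_insert hi, Finset.sum_insert hi]
    have h0 : 0 ≤ ∑ i ∈ s, f i := Finset.sum_nonneg fun i _ => hf i
    have := NNReal.rpow_add_le_add_rpow ⟨f i, hf i⟩ ⟨∑ i ∈ s, f i, h0⟩ hq.1.le hq.2
    have h2 : (f i + ∑ i ∈ s, f i) ^ q ≤ f i ^ q + (∑ i ∈ s, f i) ^ q := by exact_mod_cast this
    linarith

theorem discreteSimplex_subset {ε : ℝ} (hε : 0 < ε) :
    discreteSimplex K ε ⊆ stdSimplex ℝ (Fin K) := fun _ ha =>
  ⟨fun i => (half_pos hε).le.trans (ha.2.1 i), ha.2.2⟩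

theorem card_mul_le_of_mem_discreteSimplex {ε : ℝ} {a : Fin K → ℝ} (ha : a ∈ discreteSimplex K ε) :
    K * ε ≤ 2 := by
  have : ∑ _i : Fin K, ε / 2 ≤ ∑ i, a i := Finset.sum_le_sum fun i _ => ha.2.1 i
  rw [ha.2.2] at this
  simp at this
  linarith

theorem distortionRisk_nonneg {h : ℝ → ℝ} (hh : IsDistortion h) {S : Set ℝ} (hSpos : S ⊆ Ici 0)
    {G : Measure ℝ} (hG : G ∈ FiniteMean S) : 0 ≤ distortionRisk h G := by
  have := hG.1
  have hneg : G (Iio 0) = 0 :=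
    measure_mono_null (fun x hx hxS => not_lt.2 (mem_Ici.1 (hSpos hxS)) hx) hG.2.1
  have h1 : ∫ x in Iic (0 : ℝ), (h (1 - cdf G x) - h 1) = 0 := by
    -- An atom at `0` could make the integrand nonzero at that point, which is negligible.
    rw [integral_Iic_eq_integral_Iio]
    refine setIntegral_eq_zero_of_forall_eq_zero fun x hx => ?_
    have : cdf G x = 0 := by
      rw [cdf_eq_real, measureReal_def, measure_mono_null (Iic_subset_Iio.2 hx) hneg]
      rfl
    rw [this, sub_zero, sub_self]
  rw [distortionRisk, h1, zero_add]
  refine setIntegral_nonneg measurableSet_Ioi fun x _ => (hh.mapsTo _ ?_).1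
  exact ⟨by linarith [cdf_le_one G x], by linarith [cdf_nonneg G x]⟩

variable {h : ℝ → ℝ} {S : Set ℝ} {F : Fin K → Measure ℝ} {q L : ℝ}

theorem IsHolderRisk.abs_mixValue_sub_le (hHolder : IsHolderRisk h S F q L) (hq : 0 ≤ q)
    (hL : 0 ≤ L) (hF : ∀ i, F i ∈ FiniteMean S) {η : Fin K → Measure ℝ}
    (hη : ∀ i, η i ∈ FiniteMean S) {a : Fin K → ℝ} (ha : a ∈ stdSimplex ℝ (Fin K))
    {d : Fin K → ℝ} (hd : ∀ i, 0 ≤ d i) (hD : ∀ i, cdfDist (F i) (η i) ≤ ENNReal.ofReal (d i)) :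
    |mixValue h F a - mixValue h η a| ≤ L * (∑ i, a i * d i) ^ q := by
  have hmη := mixture_mem_finiteMean ha hη
  have := (mixture_mem_finiteMean ha hF).1
  have := hmη.1
  have h0 : 0 ≤ ∑ i, a i * d i := Finset.sum_nonneg fun i _ => mul_nonneg (ha.1 i) (hd i)
  refine (hHolder.holder _ ⟨a, ha, rfl⟩ _ hmη).trans (mul_le_mul_of_nonneg_left ?_ hL)
  refine Real.rpow_le_rpow ENNReal.toReal_nonneg (ENNReal.toReal_le_of_le_ofReal h0 ?_) hq
  refine (wasserstein_le_cdfDist _ _).trans ((cdfDist_mixture_le ha (fun i => (hF i).1)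
    fun i => (hη i).1).trans ?_)
  rw [ENNReal.ofReal_sum_of_nonneg fun i _ => mul_nonneg (ha.1 i) (hd i)]
  refine Finset.sum_le_sum fun i _ => ?_
  rw [ENNReal.ofReal_mul (ha.1 i)]
  exact mul_le_mul_right (hD i) _

theorem IsHolderRisk.plugin_bounds (hHolder : IsHolderRisk h S F q L) (hq : q ∈ Ioc (0 : ℝ) 1)
    (hL : 0 ≤ L) (hF : ∀ i, F i ∈ FiniteMean S) {η : Fin K → Measure ℝ}
    (hη : ∀ i, η i ∈ FiniteMean S) {a : Fin K → ℝ} (ha : a ∈ stdSimplex ℝ (Fin K))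
    {c : Fin K → ℝ} (hc : ∀ i, 0 ≤ c i) (hD : ∀ i, cdfDist (η i) (F i) ≤ ENNReal.ofReal (c i)) :
    mixValue h F a ≤ mixValue h η a + L * ∑ i, (a i * c i) ^ q ∧
      mixValue h η a + L * ∑ i, (a i * c i) ^ q ≤
        mixValue h F a + 2 * L * ∑ i, (a i * c i) ^ q := by
  have h1 := hHolder.abs_mixValue_sub_le hq.1.le hL hF hη ha hc
    (fun i => (cdfDist_comm _ _).trans_le (hD i))
  have h2 := mul_le_mul_of_nonneg_left (Real.rpow_sum_le_sum_rpow Finset.univ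
    (fun i => mul_nonneg (ha.1 i) (hc i)) hq) hL
  have h3 := abs_le.1 (h1.trans h2)
  constructor <;> linarith [h3.1, h3.2]

/-- The true arms are admissible, which gives the lower bound. Every admissible choice is within `2
c i` of `F i` by the triangle inequality, and `2 ^ q ≤ 2`. Comparing with `F` rather than `η` is
essential, since Hölder continuity needs one argument in the hull of the arms. -/
theorem IsHolderRisk.sSup_bounds (hHolder : IsHolderRisk h S F q L) (hq : q ∈ Ioc (0 : ℝ) 1)
    (hL : 0 ≤ L) (hF : ∀ i, F i ∈ FiniteMean S) {η : Fin K → Measure ℝ}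
    (hη : ∀ i, η i ∈ FiniteMean S) {a : Fin K → ℝ} (ha : a ∈ stdSimplex ℝ (Fin K))
    {c : Fin K → ℝ} (hc : ∀ i, 0 ≤ c i) (hD : ∀ i, cdfDist (η i) (F i) ≤ ENNReal.ofReal (c i)) :
    let s := {v | ∃ θ : Fin K → Measure ℝ, (∀ i, θ i ∈ FiniteMean S ∧
      wasserstein (η i) (θ i) ≤ ENNReal.ofReal (c i)) ∧ v = mixValue h θ a}
    mixValue h F a ≤ sSup s ∧ sSup s ≤ mixValue h F a + 2 * L * ∑ i, (a i * c i) ^ q := by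
  intro s
  have hac : ∀ i, 0 ≤ a i * c i := fun i => mul_nonneg (ha.1 i) (hc i)
  have hFs : mixValue h F a ∈ s := by
    refine ⟨F, fun i => ⟨hF i, ?_⟩, rfl⟩
    have := (hF i).1
    have := (hη i).1
    exact (wasserstein_le_cdfDist _ _).trans (hD i)
  have hub : ∀ v ∈ s, v ≤ mixValue h F a + 2 * L * ∑ i, (a i * c i) ^ q := by
    rintro v ⟨θ, hθ, rfl⟩
    have hd : ∀ i, cdfDist (F i) (θ i) ≤ ENNReal.ofReal (2 * c i) := by
      intro i
      have := (hη i).1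
      have := (hθ i).1.1
      rw [two_mul, ENNReal.ofReal_add (hc i) (hc i)]
      refine (cdfDist_triangle _ (η i) _).trans (add_le_add ?_ ?_)
      · rw [cdfDist_comm]; exact hD i
      · exact (cdfDist_le_wasserstein _ _).trans (hθ i).2
    have h1 := hHolder.abs_mixValue_sub_le hq.1.le hL hF (fun i => (hθ i).1) ha
      (fun i => mul_nonneg zero_le_two (hc i)) hd
    have e : ∑ i, a i * (2 * c i) = 2 * ∑ i, a i * c i := by
      rw [Finset.mul_sum]; exact Finset.sum_congr rfl fun i _ => by ring
    have h2 : (∑ i, a i * (2 * c i)) ^ q ≤ 2 * ∑ i, (a i * c i) ^ q := by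
      rw [e, Real.mul_rpow zero_le_two (Finset.sum_nonneg fun i _ => hac i)]
      refine mul_le_mul ?_ (Real.rpow_sum_le_sum_rpow Finset.univ hac hq)
        (Real.rpow_nonneg (Finset.sum_nonneg fun i _ => hac i) _) zero_le_two
      calc (2 : ℝ) ^ q ≤ 2 ^ (1 : ℝ) := Real.rpow_le_rpow_of_exponent_le one_le_two hq.2
        _ = 2 := Real.rpow_one 2
    have h3 := (abs_le.1 (h1.trans (mul_le_mul_of_nonneg_left h2 hL))).1
    linarith
  exact ⟨le_csSup ⟨_, hub⟩ hFs, csSup_le ⟨_, hFs⟩ hub⟩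

/-- As `2 / ε ≥ 1`, the threshold is at least `T₀ - 1`, and an integer above `T₀ - 1` is at least
`T₀`. -/
theorem mem_goodTimes_of_horizonThreshold_lt {gap : ℝ≥0∞} {ρ ε : ℝ} (hε : 0 < ε) (hε2 : ε ≤ 2) {T : ℕ}
    (hT : horizonThreshold K gap L q ρ ε < T) : T ∈ goodTimes K gap L q ρ ε := by
  have hlt : burnIn K gap L q ρ ε < (T + 1 : ℕ) := by
    by_contra hge
    rw [not_lt] at hge
    refine absurd hT (not_lt.2 ?_)
    have h1 : ((T + 1 : ℕ) : ℝ≥0∞) ≤ (burnIn K gap L q ρ ε : ℝ≥0∞) := by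
      have := ENat.toENNReal_le.2 hge
      simpa using this
    have h2 : (T : ℝ≥0∞) ≤ (burnIn K gap L q ρ ε : ℝ≥0∞) - 1 :=
      ENNReal.le_sub_of_add_le_right ENNReal.one_ne_top (by exact_mod_cast h1)
    have h3 : (1 : ℝ≥0∞) ≤ ENNReal.ofReal (2 / ε) := by
      rw [ENNReal.one_le_ofReal, le_div_iff₀ hε]; linarith
    exact h2.trans (le_mul_of_one_le_left zero_le h3)
  unfold burnIn at hlt
  obtain ⟨t, ht⟩ := iInf_lt_iff.1 hlt
  obtain ⟨ht1, ht2⟩ := iInf_lt_iff.1 ht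
  have : t < T + 1 := by exact_mod_cast ht2
  exact ht1.2 T (by omega)

/-- For another mixture the gap would be at most `2 L ∑ (a i c i) ^ q < 2 K L (16 c₀) ^ q`, while
membership in `goodTimes` says that the right-hand side is at most the minimum gap. -/
theorem eq_of_optimism {q L ρ ε : ℝ} (hq : q ∈ Ioc (0 : ℝ) 1) (hL : 0 ≤ L)
    {astar : Fin K → ℝ} {T : ℕ} (hρTε : 0 < ρ / 4 * T * ε)
    (hε : 0 < ε) (hastar : astar ∈ discreteSimplex K ε)
    (hgood : T ∈ goodTimes K (minGap h F ε astar) L q ρ ε) {a : Fin K → ℝ}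
    (ha : a ∈ discreteSimplex K ε) {c : Fin K → ℝ} (hc0 : ∀ i, 0 ≤ c i)
    (hc : ∀ i, c i ≤ 16 * ((√(2 * Real.exp 1 * Real.log T) + 32) / √(ρ / 4 * T * ε)))
    (hopt : mixValue h F astar ≤ mixValue h F a + 2 * L * ∑ i, (a i * c i) ^ q) : a = astar := by
  by_contra hne
  set c₀ := (√(2 * Real.exp 1 * Real.log T) + 32) / √(ρ / 4 * T * ε) with hc₀
  have hc₀pos : 0 < c₀ := by
    have := Real.sqrt_pos.2 hρTε
    positivity
  set d := mixValue h F astar - mixValue h F a with hd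
  have hgap : minGap h F ε astar ≤ ENNReal.ofReal d := iInf₂_le a ⟨ha, hne⟩
  have hineq := hgood.2
  have hineq2 : ENNReal.ofReal c₀ ≤
      (1 / 16) * (ENNReal.ofReal d / ENNReal.ofReal (2 * K * L)) ^ (1 / q) :=
    hineq.trans (mul_le_mul_right (ENNReal.rpow_le_rpow (ENNReal.div_le_div_right hgap _)
      (by have := hq.1; positivity)) _)
  have hdpos : 0 < d := by
    by_contra hd0
    rw [ENNReal.ofReal_of_nonpos (not_lt.1 hd0), ENNReal.zero_div,
      ENNReal.zero_rpow_of_pos (by have := hq.1; positivity), mul_zero] at hineq2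
    exact absurd (ENNReal.ofReal_pos.2 hc₀pos) (not_lt.2 hineq2)
  -- For `L = 0` the quotient in `goodTimes` is infinite and carries no information, but then the
  -- optimism inequality itself contradicts `0 < d`.
  have hLpos : 0 < L := by
    refine hL.lt_of_ne fun h0 => ?_
    rw [← h0] at hopt
    simp only [mul_zero, zero_mul, add_zero] at hopt
    linarith
  -- A second arm, with weight at least `ε / 2`, forces `a i < 1`, the source of the strict
  -- inequality. With a single arm the simplex is a point.
  have hnt : Nontrivial (Fin K) := by
    by_contra hsub
    rw [not_nontrivial_iff_subsingleton] at hsub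
    refine hne (funext fun i => ?_)
    have e1 := ha.2.2
    have e2 := hastar.2.2
    rw [Fintype.sum_subsingleton _ i] at e1 e2
    rw [e1, e2]
  have hapos : ∀ i, 0 < a i := fun i => (half_pos hε).trans_le (ha.2.1 i)
  have halt : ∀ i, a i < 1 := by
    intro i
    obtain ⟨j, hj⟩ := exists_ne i
    have : a i + a j ≤ ∑ k, a k := by
      rw [← Finset.sum_pair hj.symm]
      exact Finset.sum_le_sum_of_subset_of_nonneg (Finset.subset_univ _) fun k _ _ => (hapos k).le
    rw [ha.2.2] at this
    linarith [hapos j]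
  have hsum : ∑ i, (a i * c i) ^ q < K * (16 * c₀) ^ q := by
    calc ∑ i, (a i * c i) ^ q < ∑ _i : Fin K, (16 * c₀) ^ q := by
          refine Finset.sum_lt_sum_of_nonempty Finset.univ_nonempty fun i _ => ?_
          refine Real.rpow_lt_rpow (mul_nonneg (hapos i).le (hc0 i)) ?_ hq.1
          calc a i * c i ≤ a i * (16 * c₀) := mul_le_mul_of_nonneg_left (hc i) (hapos i).le
            _ < 1 * (16 * c₀) := mul_lt_mul_of_pos_right (halt i) (by positivity)
            _ = _ := one_mul _
      _ = _ := by simp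
  have hKpos : (0 : ℝ) < K := by
    have : 0 < K := Fin.pos (Classical.arbitrary (Fin K))
    exact_mod_cast this
  have hKL : 0 < 2 * K * L := by positivity
  have hr0 : 0 ≤ d / (2 * K * L) := by positivity
  rw [← ENNReal.ofReal_div_of_pos hKL, ENNReal.ofReal_rpow_of_nonneg hr0
    (by have := hq.1; positivity)] at hineq2
  have h16 : (1 / 16 : ℝ≥0∞) = ENNReal.ofReal (1 / 16) := by
    rw [ENNReal.ofReal_div_of_pos (by norm_num)]; simp
  rw [h16, ← ENNReal.ofReal_mul (by norm_num), ENNReal.ofReal_le_ofReal_iff (by positivity)]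
    at hineq2
  have hcq : (16 * c₀) ^ q ≤ d / (2 * K * L) := by
    calc (16 * c₀) ^ q ≤ ((d / (2 * K * L)) ^ (1 / q)) ^ q :=
          Real.rpow_le_rpow (by positivity) (by linarith) hq.1.le
      _ = _ := by rw [← Real.rpow_mul hr0, one_div_mul_cancel hq.1.ne', Real.rpow_one]
  rw [le_div_iff₀ hKL] at hcq
  have := mul_lt_mul_of_pos_left hsum (by positivity : 0 < 2 * L)
  linarith

end Optimism

/-! ### Tracking a fixed target mixture. -/

section Tracking

variable {K : ℕ} {Ω : Type*}

/-- The deficits `t a j - τ_t(j)` add up to zero, so the largest is nonnegative: an arm is pulled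
only if its count is at most `t a i ≤ T a i`, and the pull adds one. -/
theorem pullCount_le_of_tracking {A : ℕ → Ω → Fin K} {ω : Ω} {a : Fin K → ℝ} {N₀ T : ℕ}
    (ha : a ∈ stdSimplex ℝ (Fin K)) (hN : N₀ ≤ T)
    (hinit : ∀ i, (pullCount A N₀ i ω : ℝ) ≤ T * a i)
    (htrack : ∀ t, N₀ ≤ t → t < T →
      A t ω ∈ argmaxOn (fun i => (t : ℝ) * a i - pullCount A t i ω) univ) (i : Fin K) :
    (pullCount A T i ω : ℝ) ≤ T * a i + 1 := by
  suffices H : ∀ t, N₀ ≤ t → t ≤ T → ∀ i, (pullCount A t i ω : ℝ) ≤ T * a i + 1 from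
    H T hN le_rfl i
  intro t ht
  induction t, ht using Nat.le_induction with
  | base => exact fun _ i => (hinit i).trans (by linarith)
  | succ t ht ih =>
    intro htT i
    rw [pullCount_succ]
    by_cases hA : A t ω = i
    · rw [if_pos hA]
      have hmax := (htrack t ht (by omega)).2
      rw [hA] at hmax
      have hsum : ∑ j, ((t : ℝ) * a j - pullCount A t j ω) = 0 := by
        rw [Finset.sum_sub_distrib, ← Finset.mul_sum, ha.2, ← Nat.cast_sum, sum_pullCount]
        ring
      have h0 : 0 ≤ (t : ℝ) * a i - pullCount A t i ω := by
        by_contra hneg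
        have : ∑ j, ((t : ℝ) * a j - pullCount A t j ω) < ∑ _j : Fin K, (0 : ℝ) :=
          Finset.sum_lt_sum_of_nonempty ⟨i, Finset.mem_univ i⟩ fun j _ =>
            (hmax j (mem_univ j)).trans_lt (not_le.1 hneg)
        rw [hsum] at this
        simp at this
      have hta : (t : ℝ) * a i ≤ T * a i :=
        mul_le_mul_of_nonneg_right (by exact_mod_cast (by omega : t ≤ T)) (ha.1 i)
      push_cast
      linarith
    · rw [if_neg hA, add_zero]
      exact ih (by omega) i

theorem frequency_mem_stdSimplex (A : ℕ → Ω → Fin K) {T : ℕ} (hT : 0 < T) (ω : Ω) :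
    (fun i => (1 / T : ℝ) * pullCount A T i ω) ∈ stdSimplex ℝ (Fin K) := by
  have hT' : (0 : ℝ) < T := by exact_mod_cast hT
  refine ⟨fun i => by positivity, ?_⟩
  rw [← Finset.mul_sum, ← Nat.cast_sum, sum_pullCount]
  field_simp

theorem sum_abs_sub_frequency_le {A : ℕ → Ω → Fin K} {ω : Ω} {a : Fin K → ℝ} {T : ℕ}
    (ha : a ∈ stdSimplex ℝ (Fin K)) (hT : 0 < T)
    (h : ∀ i, (pullCount A T i ω : ℝ) ≤ T * a i + 1) :
    ∑ i, |a i - (1 / T : ℝ) * pullCount A T i ω| ≤ 2 * K / T := by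
  have hT' : (0 : ℝ) < T := by exact_mod_cast hT
  -- For `x ≥ -1/T` one has `|x| ≤ 2/T + x`, and these differences add up to zero; so the one-sided
  -- count bound is enough.
  have hpt : ∀ i, |a i - (1 / T : ℝ) * pullCount A T i ω| ≤
      2 / T + (a i - (1 / T : ℝ) * pullCount A T i ω) := by
    intro i
    have h1 : (1 / T : ℝ) * pullCount A T i ω ≤ a i + 1 / T := by
      rw [one_div, inv_mul_le_iff₀ hT']
      refine (h i).trans_eq ?_
      field_simp
    have h2 : (0 : ℝ) < 1 / T := by positivity
    have h3 : (2 : ℝ) / T = 2 * (1 / T) := by ring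
    rw [abs_le]
    constructor <;> linarith
  refine (Finset.sum_le_sum fun i _ => hpt i).trans_eq ?_
  rw [Finset.sum_add_distrib, Finset.sum_sub_distrib, ha.2,
    (frequency_mem_stdSimplex A hT ω).2]
  simp
  ring

end Tracking

/-! ### Assembly of the regret bound. -/

section Regret

variable {K : ℕ} {Ω : Type*} {mΩ : MeasurableSpace Ω} {P : Measure Ω} {F : Fin K → Measure ℝ}
  {T : ℕ} {ℱ : Filtration ℕ mΩ} {A : ℕ → Ω → Fin K} {X : ℕ → Ω → ℝ} {S : Set ℝ} {h : ℝ → ℝ}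
  {q L : ℝ}

theorem IsBanditRun.ae_reward_mem [IsProbabilityMeasure P] (hS : MeasurableSet S)
    (hF : ∀ i, F i ∈ FiniteMean S) (hrun : IsBanditRun P F T ℱ A X) :
    ∀ᵐ ω ∂P, ∀ t < T, X t ω ∈ S := by
  have hprob : ∀ i, IsProbabilityMeasure (F i) := fun i => (hF i).1
  rw [ae_all_iff]
  intro t
  by_cases ht : t < T
  · have hnull : ∀ i, P ({ω | A t ω = i} ∩ X t ⁻¹' Sᶜ) = 0 := by
      intro i
      rw [hrun.measure_inter_eq (D := {ω | A t ω = i}) ht i (hrun.action_meas t ht (measurableSet_singleton i))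
        (fun ω hω => hω) hS.compl, (hF i).2.1, mul_zero]
    filter_upwards [ae_all_iff.2 fun i => measure_eq_zero_iff_ae_notMem.1 (hnull i)] with ω hω _
    by_contra hX
    exact hω (A t ω) ⟨rfl, hX⟩
  · exact Filter.Eventually.of_forall fun ω h => absurd h ht

theorem empiricalDist_mem_finiteMean (hS : MeasurableSet S) {ω : Ω} (hX : ∀ t < T, X t ω ∈ S)
    {t : ℕ} (ht : t ≤ T) {i : Fin K} (h0 : 0 < pullCount A t i ω) :
    empiricalDist A X t i ω ∈ FiniteMean S := by
  refine ⟨(cdf_empiricalDist i h0 rfl).1, ?_, ?_⟩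
  · simp only [empiricalDist, Measure.smul_apply, Measure.finsetSum_apply, smul_eq_mul]
    rw [Finset.sum_eq_zero, mul_zero]
    intro s hs
    have hs' := Finset.mem_range.1 (Finset.mem_filter.1 hs).1
    rw [Measure.dirac_apply' _ hS.compl]
    simp [hX s (hs'.trans_le ht)]
  · refine Integrable.smul_measure ?_ (ENNReal.inv_ne_top.2 (by exact_mod_cast h0.ne'))
    exact integrable_finsetSum_measure.2 fun s _ => integrable_dirac (by simp)

theorem confRadius_nonneg (T n : ℕ) : 0 ≤ confRadius T n := by
  unfold confRadius; positivity

theorem confRadius_le {T n : ℕ} {x : ℝ} (hx : 0 < x) (hn : x ≤ n) :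
    confRadius T n ≤ 16 * ((√(2 * Real.exp 1 * Real.log T) + 32) / √x) := by
  unfold confRadius
  have := Real.sqrt_pos.2 hx
  gcongr

theorem ceIndex_bounds (hq : q ∈ Ioc (0 : ℝ) 1) (hL : 0 ≤ L) (hHolder : IsHolderRisk h S F q L)
    (hS : MeasurableSet S) (hF : ∀ i, F i ∈ FiniteMean S) {ω : Ω} (hω : ω ∉ badEvent F T A X)
    (hX : ∀ t < T, X t ω ∈ S) {t : ℕ} (ht : t < T) (h0 : ∀ i, 0 < pullCount A t i ω)
    {a : Fin K → ℝ} (ha : a ∈ stdSimplex ℝ (Fin K)) :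
    mixValue h F a ≤ ceIndex h q L T A X t ω a ∧ ceIndex h q L T A X t ω a ≤
      mixValue h F a + 2 * L * ∑ i, (a i * confRadius T (pullCount A t i ω)) ^ q :=
  hHolder.plugin_bounds hq hL hF (fun i => empiricalDist_mem_finiteMean hS hX ht.le (h0 i)) ha
    (fun _ => confRadius_nonneg _ _) fun i => cdfDist_le_of_notMem_badEvent hω i ht (h0 i)

theorem rsIndex_bounds (hq : q ∈ Ioc (0 : ℝ) 1) (hL : 0 ≤ L) (hHolder : IsHolderRisk h S F q L)
    (hS : MeasurableSet S) (hF : ∀ i, F i ∈ FiniteMean S) {ω : Ω} (hω : ω ∉ badEvent F T A X)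
    (hX : ∀ t < T, X t ω ∈ S) {t : ℕ} (ht : t < T) (h0 : ∀ i, 0 < pullCount A t i ω)
    {a : Fin K → ℝ} (ha : a ∈ stdSimplex ℝ (Fin K)) :
    mixValue h F a ≤ rsIndex h S T A X t ω a ∧ rsIndex h S T A X t ω a ≤
      mixValue h F a + 2 * L * ∑ i, (a i * confRadius T (pullCount A t i ω)) ^ q :=
  hHolder.sSup_bounds hq hL hF (fun i => empiricalDist_mem_finiteMean hS hX ht.le (h0 i)) ha
    (fun _ => confRadius_nonneg _ _) fun i => cdfDist_le_of_notMem_badEvent hω i ht (h0 i)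

/-- The value factors through the vector of counts, which lives in a countable space, so no
regularity of the riskmetric is required. -/
theorem IsBanditRun.measurable_mixValue_frequency (hrun : IsBanditRun P F T ℱ A X) :
    Measurable fun ω => mixValue h F (fun i => (1 / T : ℝ) * pullCount A T i ω) := by
  have h1 : Measurable fun ω => fun i => pullCount A T i ω :=
    measurable_pi_lambda _ fun i => (hrun.measurable_pullCount i T le_rfl).mono (ℱ.le T) le_rfl
  exact (measurable_of_countable fun n : Fin K → ℕ =>
    mixValue h F (fun i => (1 / T : ℝ) * n i)).comp h1

/-- The regret bound for any index that lies between the value of a mixture and the value plus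
twice the Hölder bonus, off the bad event. -/
theorem regret_le_of_index_bounds [IsProbabilityMeasure P]
    (hS : MeasurableSet S) (hSpos : S ⊆ Ici 0) (hF : ∀ i, F i ∈ FiniteMean S)
    (hsub : ∀ i, HasSubgaussianMGF (fun x : ℝ => x - ∫ y, y ∂(F i)) 1 (F i))
    (hh : IsDistortion h) {B : ℝ} (hq : q ∈ Ioc (0 : ℝ) 1) (hL : 0 ≤ L)
    (hHolder : IsHolderRisk h S F q L) (hB : 0 < B) (hUB : ∀ G ∈ armHull F, distortionRisk h G ≤ B)
    {ρ ε : ℝ} (hρ : ρ ∈ Ioo (0 : ℝ) 1) (hε : 0 < ε) {αstar astar : Fin K → ℝ}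
    (hα : αstar ∈ argmaxOn (mixValue h F) (stdSimplex ℝ (Fin K)))
    (ha : astar ∈ argmaxOn (mixValue h F) (discreteSimplex K ε))
    (hT : Real.exp K < T)
    (hTε : horizonThreshold K (minGap h F ε astar) L q ρ ε < (T : ℝ≥0∞))
    (hrun : IsBanditRun P F T ℱ A X) {a : ℕ → Ω → Fin K → ℝ}
    {index : ℕ → Ω → (Fin K → ℝ) → ℝ} (hpolicy : FollowsUCB P ρ ε T index A a)
    (hindex : ∀ ω ∉ badEvent F T A X, (∀ t < T, X t ω ∈ S) → ∀ t < T,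
      (∀ i, 0 < pullCount A t i ω) → ∀ b ∈ stdSimplex ℝ (Fin K),
      mixValue h F b ≤ index t ω b ∧ index t ω b ≤
        mixValue h F b + 2 * L * ∑ i, (b i * confRadius T (pullCount A t i ω)) ^ q) :
    regret P h F αstar T A ≤
      (B + L * (mixRatio F ^ q + 1)) *
          (64 / √(ε * ρ * T) * (√(2 * Real.exp 1 * Real.log T) + 32)) ^ q +
        (mixValue h F αstar - mixValue h F astar) := by
  set R := 64 / √(ε * ρ * T) * (√(2 * Real.exp 1 * Real.log T) + 32) with hR
  set f : Ω → ℝ := fun ω => mixValue h F (fun i => (1 / T : ℝ) * pullCount A T i ω) with hf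
  have hKT : (K : ℝ) < T := by linarith [Real.add_one_le_exp (K : ℝ)]
  have hTpos : (0 : ℝ) < T := (Nat.cast_nonneg K).trans_lt hKT
  have hTpos' : 0 < T := by exact_mod_cast hTpos
  have hK : 0 < K := by
    rcases Nat.eq_zero_or_pos K with rfl | hK
    · have := hα.1.2
      simp at this
    · exact hK
  have hK' : (1 : ℝ) ≤ K := by exact_mod_cast hK
  have hKε : K * ε ≤ 2 := card_mul_le_of_mem_discreteSimplex ha.1
  have hε2 : ε ≤ 2 := by nlinarith
  have hρ0 := hρ.1
  have hερT : 0 < ε * ρ * T := by positivity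
  have hsqrt := Real.sqrt_pos.2 hερT
  have hR0 : 0 < R := by positivity
  have hdis := discreteSimplex_subset (K := K) hε
  have hfreq := fun ω => frequency_mem_stdSimplex A hTpos' ω
  have hf0 : ∀ ω, 0 ≤ f ω := fun ω =>
    distortionRisk_nonneg hh hSpos (mixture_mem_finiteMean (hfreq ω) hF)
  have hfB : ∀ ω, f ω ≤ B := fun ω => hUB _ ⟨_, hfreq ω, rfl⟩
  have hΔ : mixValue h F astar ≤ mixValue h F αstar := hα.2 _ (hdis ha.1)
  have hW := Real.rpow_nonneg (mixRatio_nonneg F) q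
  have hLW : 0 ≤ L * (mixRatio F ^ q + 1) := by positivity
  rcases le_or_gt 1 R with hR1 | hR1
  · have hRq : 1 ≤ R ^ q := Real.one_le_rpow hR1 hq.1.le
    have h1 : regret P h F αstar T A ≤ B := by
      have : 0 ≤ ∫ ω, f ω ∂P := integral_nonneg hf0
      have : mixValue h F αstar ≤ B := hUB _ ⟨αstar, hα.1, rfl⟩
      simp only [hf] at *
      unfold regret
      linarith
    nlinarith
  have hlarge : 4 < ε * ρ * T := by
    have h1 : 2048 / √(ε * ρ * T) ≤ R := by
      rw [hR, div_mul_eq_mul_div]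
      gcongr
      linarith [Real.sqrt_nonneg (2 * Real.exp 1 * Real.log T)]
    have h2 : 2048 < √(ε * ρ * T) := by
      have := h1.trans_lt hR1
      rwa [div_lt_one hsqrt] at this
    have h3 := Real.sq_sqrt hερT.le
    nlinarith
  -- This uses `K ε ≤ 2`, which holds because the discretized simplex is nonempty, and `ρ < 1`.
  have hKR : 2 * K / T ≤ R := by
    have h1 : K * √(ε * ρ * T) ≤ 2 * T := by
      have h3 := Real.sq_sqrt hερT.le
      refine abs_le_of_sq_le_sq' ?_ (by positivity) |>.2
      have h4 : K * ε * (K * (ρ * T)) ≤ 2 * (T * (1 * T)) := by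
        have := hρ.2.le
        gcongr
      rw [mul_pow, h3]
      nlinarith
    have h2 : 2 * K / T ≤ 2048 / √(ε * ρ * T) := by
      rw [div_le_div_iff₀ hTpos hsqrt]
      nlinarith
    refine h2.trans ?_
    rw [hR, div_mul_eq_mul_div]
    gcongr
    linarith [Real.sqrt_nonneg (2 * Real.exp 1 * Real.log T)]
  set N := exploreCount ρ ε T with hN
  have hNge : ρ * T * ε / 4 ≤ N := Nat.le_ceil _
  have hNlt : (N : ℝ) < ρ * T * ε / 4 + 1 := Nat.ceil_lt_add_one (by positivity)
  have hNpos : 0 < N := Nat.ceil_pos.2 (by positivity)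
  -- Since `ρ T ε / 4 > 1`, rounding up at most doubles the exploration length. Hence forced
  -- exploration overshoots no target `T * astar i`, the starting condition for tracking.
  have hNε : (N : ℝ) ≤ T * (ε / 2) := by
    have : ρ * (T * ε) ≤ 1 * (T * ε) := mul_le_mul_of_nonneg_right hρ.2.le (by positivity)
    nlinarith
  have hKN : K * N ≤ T := by
    have : (K : ℝ) * N ≤ T := by
      calc (K : ℝ) * N ≤ K * (T * (ε / 2)) := by gcongr
        _ = T * (K * ε / 2) := by ring
        _ ≤ T * 1 := by gcongr; linarith
        _ = T := mul_one _
    exact_mod_cast this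
  have hgoodT := mem_goodTimes_of_horizonThreshold_lt hε hε2 hTε
  have hρTε : 0 < ρ / 4 * T * ε := by positivity
  set v := mixValue h F astar - L * mixRatio F ^ q * R ^ q with hv
  have hvB : v ≤ B := by
    have : mixValue h F astar ≤ B := hUB _ ⟨astar, hdis ha.1, rfl⟩
    have : 0 ≤ L * mixRatio F ^ q * R ^ q := by positivity
    linarith
  have hgood : ∀ᵐ ω ∂P, ω ∉ badEvent F T A X → v ≤ f ω := by
    filter_upwards [hrun.ae_reward_mem hS hF, hpolicy.explore, hpolicy.optimistic, hpolicy.track]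
      with ω hX hexp hopt htrack hω
    have haeq : ∀ t, K * N ≤ t → t < T → a t ω = astar := by
      intro t ht htT
      have hcount : ∀ i, N ≤ pullCount A t i ω := fun i =>
        (hexp i).symm.le.trans (pullCount_mono A i ω ht)
      have hpos : ∀ i, 0 < pullCount A t i ω := fun i => hNpos.trans_le (hcount i)
      obtain ⟨hat, hmax⟩ := hopt t ht htT
      have h1 := (hindex ω hω hX t htT hpos _ (hdis ha.1)).1
      have h2 := (hindex ω hω hX t htT hpos _ (hdis hat)).2
      refine eq_of_optimism hq hL hρTε hε ha.1 hgoodT hat (fun _ => confRadius_nonneg _ _)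
        (fun i => ?_) (h1.trans ((hmax _ ha.1).trans h2))
      refine confRadius_le hρTε (le_trans ?_ (Nat.cast_le.2 (hcount i)))
      linarith
    have hpull := pullCount_le_of_tracking (A := A) (ω := ω) (hdis ha.1) hKN
      (fun i => by
        rw [hexp i]
        exact hNε.trans (mul_le_mul_of_nonneg_left (ha.1.2.1 i) hTpos.le))
      (fun t ht htT => by
        have := htrack t ht htT
        rwa [haeq t ht htT] at this)
    have hdist := (sum_abs_sub_frequency_le (hdis ha.1) hTpos' hpull).trans hKR
    have hwass := wasserstein_mixture_le_mixRatio hF (hdis ha.1) (hfreq ω)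
    have hhol := hHolder.holder _ ⟨astar, hdis ha.1, rfl⟩ _ (mixture_mem_finiteMean (hfreq ω) hF)
    have hpow : (wasserstein (mixture astar F)
        (mixture (fun i => (1 / T : ℝ) * pullCount A T i ω) F)).toReal ^ q ≤
        mixRatio F ^ q * R ^ q := by
      rw [← Real.mul_rpow (mixRatio_nonneg F) hR0.le]
      exact Real.rpow_le_rpow ENNReal.toReal_nonneg
        (hwass.trans (mul_le_mul_of_nonneg_left hdist (mixRatio_nonneg F))) hq.1.le
    have h3 := (abs_le.1 (hhol.trans (mul_le_mul_of_nonneg_left hpow hL))).2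
    simp only [hv, hf, mixValue]
    linarith
  have hbadm := hrun.measurableSet_badEvent
  -- The chain is `K / T ^ 2 ≤ 2 K / T ≤ R ≤ R ^ q`, the last step because `R < 1` and `q ≤ 1`.
  have hbad : P.real (badEvent F T A X) ≤ R ^ q := by
    refine (hrun.measure_badEvent_le hF hsub hTpos').trans (le_trans ?_
      (Real.self_le_rpow_of_le_one hR0.le hR1.le hq.2))
    refine le_trans ?_ hKR
    have hT1 : (1 : ℝ) ≤ T := by exact_mod_cast hTpos'
    rw [div_le_div_iff₀ (by positivity) hTpos]
    have : (K : ℝ) * T * 1 ≤ K * T * T := by gcongr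
    nlinarith
  have hfi : Integrable f P := by
    refine Integrable.of_bound (hrun.measurable_mixValue_frequency).aestronglyMeasurable B
      (Filter.Eventually.of_forall fun ω => ?_)
    rw [Real.norm_eq_abs, abs_of_nonneg (hf0 ω)]
    exact hfB ω
  have hgi : Integrable ((badEvent F T A X).indicator fun _ => B) P :=
    (integrable_const B).indicator hbadm
  have hint : v - B * P.real (badEvent F T A X) ≤ ∫ ω, f ω ∂P := by
    have e : ∫ ω, (v - (badEvent F T A X).indicator (fun _ => B) ω) ∂P =
        v - B * P.real (badEvent F T A X) := by
      rw [integral_sub (integrable_const v) hgi, integral_indicator_const _ hbadm]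
      simp [mul_comm]
    rw [← e]
    refine integral_mono_ae ((integrable_const v).sub hgi) hfi ?_
    filter_upwards [hgood] with ω hω
    by_cases hb : ω ∈ badEvent F T A X
    · simp only [indicator_of_mem hb]
      linarith [hf0 ω]
    · simp only [indicator_of_notMem hb, sub_zero]
      exact hω hb
  have hBbad := mul_le_mul_of_nonneg_left hbad hB.le
  have hLR : 0 ≤ L * R ^ q := by positivity
  unfold regret
  simp only [hf] at hint
  linarith [hint, hBbad, hLR]

end Regret
theorem theorem3 {K : ℕ} {Ω : Type*} {mΩ : MeasurableSpace Ω} (P : Measure Ω) [IsProbabilityMeasure P]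
    -- the bandit instance and the riskmetric
    (S : Set ℝ) (hS : MeasurableSet S) (hSpos : S ⊆ Ici 0)
    (F : Fin K → Measure ℝ) (hF : ∀ i, F i ∈ FiniteMean S)
    (hsub : ∀ i, HasSubgaussianMGF (fun x : ℝ => x - ∫ y, y ∂(F i)) 1 (F i))
    (h : ℝ → ℝ) (hh : IsDistortion h)
    (q L B : ℝ) (hq : q ∈ Ioc (0 : ℝ) 1) (hL : 0 ≤ L) (hHolder : IsHolderRisk h S F q L)
    (hB : 0 < B) (hUB : ∀ G ∈ armHull F, distortionRisk h G ≤ B)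
    -- the parameters of the algorithms and the optimal mixtures
    (ρ ε : ℝ) (hρ : ρ ∈ Ioo (0 : ℝ) 1) (hε : 0 < ε)
    (αstar : Fin K → ℝ) (hα : αstar ∈ argmaxOn (mixValue h F) (stdSimplex ℝ (Fin K)))
    (astar : Fin K → ℝ) (ha : astar ∈ argmaxOn (mixValue h F) (discreteSimplex K ε))
    (T : ℕ) (hT : Real.exp K < T)
    (hTε : horizonThreshold K (minGap h F ε astar) L q ρ ε < (T : ℝ≥0∞))
    -- the run of the policy
    (ℱ : Filtration ℕ mΩ)
    (A : ℕ → Ω → Fin K) (X : ℕ → Ω → ℝ) (hrun : IsBanditRun P F T ℱ A X)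
    (a : ℕ → Ω → Fin K → ℝ)
    (hpolicy : FollowsUCB P ρ ε T (rsIndex h S T A X) A a ∨
      FollowsUCB P ρ ε T (ceIndex h q L T A X) A a) :
    regret P h F αstar T A ≤
      (B + L * (mixRatio F ^ q + 1)) *
          (64 / √(ε * ρ * T) * (√(2 * Real.exp 1 * Real.log T) + 32)) ^ q +
        (mixValue h F αstar - mixValue h F astar) := by
  rcases hpolicy with hpol | hpol
  · exact regret_le_of_index_bounds hS hSpos hF hsub hh hq hL hHolder hB hUB hρ hε hα ha hT hTε hrun
      hpol fun _ hω hX _ ht h0 _ hb => rsIndex_bounds hq hL hHolder hS hF hω hX ht h0 hb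
  · exact regret_le_of_index_bounds hS hSpos hF hsub hh hq hL hHolder hB hUB hρ hε hα ha hT hTε hrun
      hpol fun _ hω hX _ ht h0 _ hb => ceIndex_bounds hq hL hHolder hS hF hω hX ht h0 hb
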